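/- Let $(W,S)$ be a Coxeter system and let $T$ be its set of reflections (the $W$-conjugates of elements of $S$). Let $V$ be a finite-dimensional vector space over a field $k$ of characteristic different from $2$, with a faithful linear action of $W$ such that each $s\in S$ acts as a reflection, that is, there are $\alpha_s\in V$ and $\alpha_s^\vee\in V^*$ with $\alpha_s^\vee(\alpha_s)=2$ and $sv=v-\alpha_s^\vee(v)\alpha_s$ for all $v\in V$. Then every $t\in T$ acts as a reflection in this sense; let $\alpha_t$ denote its root, which is unique up to a nonzero scalar. Assume the GKM condition: if $\alpha_t$ and $\alpha_{t'}$ are proportional for $t,t'\in T$, then $t=t'$. Grade $\mathrm{Sym}(V)$ so that the elements of $V$ have degree $2$, let $\sigma\subset\mathrm{Sym}(V)$ be a $W$-invariant multiplicative subset (containing $1$) of nonzero homogeneous elements, none of which is divisible by a root $\alpha_t$, $t\in T$, and let $R=\sigma^{-1}\mathrm{Sym}(V)$, a $\mathbb Z$-graded commutative ring with $W$-action. For $w\in W$, let $R_w$ be the graded $R$-bimodule that is $R$ as a graded abelian group, with left action $r\cdot m=rm$ and right action $m\cdot r=m\,w(r)$. For a reflection expression $\underline t=(t_1,\dots,t_n)$,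 that is, a finite (possibly empty) sequence of elements of $T$, let $$R(\underline t)=R\otimes_{R^{t_1}}R\otimes_{R^{t_2}}\cdots\otimes_{R^{t_n}}R$$ be the Bott–Samelson bimodule, where $R^{t}$ is the subring of $t$-invariants of $R$ and $R(\emptyset)=R$. For graded $R$-bimodules $M,N$, let $\mathrm{Hom}^\bullet_{R\text{-bim}}(M,N)=\bigoplus_{n\in\mathbb Z}\mathrm{Hom}^n_{R\text{-bim}}(M,N)$, where $\mathrm{Hom}^n$ consists of the bimodule homomorphisms $\varphi$ with $\varphi(M_i)\subset N_{n+i}$ for all $i$; it is a graded $R$-bimodule by $(r\varphi)(m)=r\varphi(m)$ and $(\varphi r)(m)=\varphi(m)r$. For a graded left or right $R$-module $M$, let $M^\vee=\mathrm{Hom}^\bullet_R(M,R)$ be its graded dual (defined in the same way with one-sided homomorphisms), and call $M$ reflexive if the natural map $M\to M^{\vee\vee}$ is an isomorphism. **Theorem.** For any reflection expressions $\underline t$ and $\underline t'$ and any $x,y,z,w\in W$, the graded $R$-bimodule $$\mathrm{Hom}^\bullet_{R\text{-bim}}\bigl(R_x\otimes_R R(\underline t)\otimes_R R_y,\;R_z\otimes_R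 R(\underline t')\otimes_R R_w\bigr)$$ is reflexive both as a graded left $R$-module and as a graded right $R$-module. -/

import Mathlib

noncomputable section

universe u

open DirectSum TensorProduct

set_option linter.unusedSectionVars false

namespace Soergel

section Internal

variable {M : Type u} [AddCommGroup M] (deg : ℤ → AddSubgroup M)

theorem homog_induction (hspan : ⨆ n, deg n = ⊤) {C : M → Prop}
    (mem : ∀ n, ∀ m ∈ deg n, C m) (zero : C 0) (add : ∀ x y, C x → C y → C (x + y)) (m : M) :
    C m :=
  AddSubgroup.iSup_induction deg (C := C) (hspan ▸ AddSubgroup.mem_top m) mem zero add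

/-- A criterion for `M = ⨁ deg n`: the subgroups `deg n` generate `M` and each nonzero element of
`deg k` is detected by an additive map that kills all other `deg i`. -/
theorem isInternal_of_detect {X : Type u} [AddCommGroup X] (hspan : ⨆ n, deg n = ⊤)
    (h : ∀ k, ∀ x ∈ deg k, x ≠ 0 →
      ∃ P : M →+ X, P x ≠ 0 ∧ ∀ i, i ≠ k → ∀ y ∈ deg i, P y = 0) :
    DirectSum.IsInternal deg := by
  classical
  constructor
  · rw [injective_iff_map_eq_zero]
    intro x hx
    refine DFinsupp.ext fun k => ?_
    by_contra hne
    have hne' : ((x k : deg k) : M) ≠ 0 := fun h0 => hne (Subtype.ext h0)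
    obtain ⟨P, hP, hP0⟩ := h k _ (x k).2 hne'
    have key : ∀ y : ⨁ i, deg i, P (DirectSum.coeAddMonoidHom deg y) = P (y k : M) := by
      intro y
      induction y using DirectSum.induction_on with
      | zero => simp
      | of i z =>
        rw [DirectSum.coeAddMonoidHom_of]
        by_cases hik : i = k
        · subst hik
          rw [DirectSum.of_eq_same]
        · rw [hP0 i hik _ z.2, DirectSum.of_eq_of_ne _ _ _ (Ne.symm hik)]
          simp
      | add a b ha hb => rw [map_add, map_add, ha, hb, DirectSum.add_apply,
          AddSubgroup.coe_add, map_add]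
    exact hP (by rw [← key x, hx, map_zero])
  · intro m
    refine homog_induction deg hspan (C := fun m => ∃ a, DirectSum.coeAddMonoidHom deg a = m)
      (fun i x hx => ⟨DirectSum.of (fun i => deg i) i ⟨x, hx⟩, by simp⟩) ⟨0, map_zero _⟩ ?_ m
    rintro _ _ ⟨a, rfl⟩ ⟨b, rfl⟩
    exact ⟨a + b, map_add _ _ _⟩

variable {deg}

theorem iSup_eq_top_of_isInternal (h : DirectSum.IsInternal deg) : ⨆ n, deg n = ⊤ := by
  classical
  refine eq_top_iff.2 fun m _ => ?_
  obtain ⟨x, rfl⟩ := h.2 m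
  induction x using DirectSum.induction_on with
  | zero => rw [map_zero]; exact zero_mem _
  | of i z => rw [DirectSum.coeAddMonoidHom_of]; exact AddSubgroup.mem_iSup_of_mem i z.2
  | add a b ha hb => rw [map_add]; exact add_mem (ha trivial) (hb trivial)

/-- Additive maps from a graded group are determined by their values at homogeneous elements. -/
theorem hom_ext_of_isInternal {X : Type*} [AddCommGroup X] (h : DirectSum.IsInternal deg)
    {f g : M →+ X} (hfg : ∀ n, ∀ m ∈ deg n, f m = g m) : f = g := by
  ext m
  exact homog_induction deg (iSup_eq_top_of_isInternal h) (C := fun m => f m = g m) hfg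
    (by rw [map_zero, map_zero]) (fun x y hx hy => by rw [map_add, map_add, hx, hy]) m

/-- The projection of a graded group to its component of degree `n`. -/
def homogProj (h : DirectSum.IsInternal deg) (n : ℤ) : M →+ M :=
  letI := h.chooseDecomposition
  (deg n).subtype.comp ((DFinsupp.evalAddMonoidHom n).comp
    (DirectSum.decomposeAddEquiv deg).toAddMonoidHom)

theorem homogProj_same (h : DirectSum.IsInternal deg) {n : ℤ} {m : M} (hm : m ∈ deg n) :
    homogProj h n m = m := by
  let _ := h.chooseDecomposition
  exact DirectSum.decompose_of_mem_same deg hm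

theorem homogProj_ne (h : DirectSum.IsInternal deg) {n k : ℤ} {m : M} (hm : m ∈ deg n)
    (hnk : n ≠ k) : homogProj h k m = 0 := by
  let _ := h.chooseDecomposition
  exact DirectSum.decompose_of_mem_ne deg hm hnk

end Internal

section Graded

variable {R : Type u} [CommRing R]

/-- A graded module over the graded commutative ring `R = ⨁ 𝒜 n`. -/
structure GrMod (𝒜 : ℤ → AddSubgroup R) where
  carrier : Type u
  [addCommGroup : AddCommGroup carrier]
  [module : Module R carrier]
  deg : ℤ → AddSubgroup carrier
  isInternal : DirectSum.IsInternal deg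
  smul_mem : ∀ {i j : ℤ} {r : R} {m : carrier}, r ∈ 𝒜 i → m ∈ deg j → r • m ∈ deg (i + j)

/-- A graded `R`-bimodule over the graded commutative ring `R = ⨁ 𝒜 n`: an abelian group with
two commuting actions `left r m = r m` and `right r m = m r` of `R`. As `R` is commutative,
a right action is also a ring homomorphism to the endomorphisms. -/
structure GrBimod (𝒜 : ℤ → AddSubgroup R) where
  carrier : Type u
  [addCommGroup : AddCommGroup carrier]
  left : R →+* AddMonoid.End carrier
  right : R →+* AddMonoid.End carrier
  comm : ∀ (r s : R) (m : carrier), left r (right s m) = right s (left r m)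
  deg : ℤ → AddSubgroup carrier
  isInternal : DirectSum.IsInternal deg
  left_mem : ∀ {i j : ℤ} {r : R} {m : carrier}, r ∈ 𝒜 i → m ∈ deg j → left r m ∈ deg (i + j)
  right_mem : ∀ {i j : ℤ} {r : R} {m : carrier}, r ∈ 𝒜 i → m ∈ deg j → right r m ∈ deg (i + j)

attribute [instance] GrMod.addCommGroup GrMod.module GrBimod.addCommGroup


section Hom

variable {𝒜 : ℤ → AddSubgroup R} [hR : GradedRing 𝒜]

theorem isInternal_ring (𝒜 : ℤ → AddSubgroup R) [GradedRing 𝒜] : DirectSum.IsInternal 𝒜 :=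
  DirectSum.Decomposition.isInternal 𝒜

variable (𝒜) in
/-- The graded ring `R` as a graded module over itself. -/
def GrMod.ring : GrMod 𝒜 where
  carrier := R
  deg := 𝒜
  isInternal := isInternal_ring 𝒜
  smul_mem hr hm := SetLike.mul_mem_graded hr hm

/-- The one-sided module underlying a graded bimodule, with the left action. -/
def GrBimod.toLeft (M : GrBimod 𝒜) : GrMod 𝒜 where
  carrier := M.carrier
  module := Module.compHom M.carrier M.left
  deg := M.deg
  isInternal := M.isInternal
  smul_mem hr hm := M.left_mem hr hm

/-- The one-sided module underlying a graded bimodule, with the right action. -/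
def GrBimod.toRight (M : GrBimod 𝒜) : GrMod 𝒜 where
  carrier := M.carrier
  module := Module.compHom M.carrier M.right
  deg := M.deg
  isInternal := M.isInternal
  smul_mem hr hm := M.right_mem hr hm

namespace GrMod

variable (M N : GrMod 𝒜)

/-- `Hom^n(M, N)`: the `R`-linear maps of degree `n`. -/
def homDeg (n : ℤ) : AddSubgroup (M.carrier →ₗ[R] N.carrier) where
  carrier := {φ | ∀ i, ∀ m ∈ M.deg i, φ m ∈ N.deg (n + i)}
  zero_mem' := fun _ _ _ => zero_mem (N.deg _)
  add_mem' := fun ha hb i m hm => add_mem (ha i m hm) (hb i m hm)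
  neg_mem' := fun ha i m hm => neg_mem (ha i m hm)

theorem smul_mem_homDeg {i n : ℤ} {r : R} {φ : M.carrier →ₗ[R] N.carrier} (hr : r ∈ 𝒜 i)
    (hφ : φ ∈ homDeg M N n) : r • φ ∈ homDeg M N (i + n) := fun k m hm => by
  rw [LinearMap.smul_apply, add_assoc]
  exact N.smul_mem hr (hφ k m hm)

/-- `Hom^•(M, N)`: the sum of all `Hom^n(M, N)` inside `Hom_R(M, N)`. -/
def homBullet : Submodule R (M.carrier →ₗ[R] N.carrier) where
  __ := ⨆ n, homDeg M N n
  smul_mem' := fun r φ hφ => by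
    change φ ∈ ⨆ n, homDeg M N n at hφ
    change r • φ ∈ ⨆ n, homDeg M N n
    refine AddSubgroup.iSup_induction _ (C := fun φ => r • φ ∈ ⨆ n, homDeg M N n) hφ ?_
      (by rw [smul_zero]; exact zero_mem _)
      (fun a b ha hb => by rw [smul_add]; exact add_mem ha hb)
    intro n φ hφ
    refine homog_induction 𝒜 (iSup_eq_top_of_isInternal (isInternal_ring 𝒜))
      (C := fun r => r • φ ∈ ⨆ n, homDeg M N n) ?_
      (by rw [zero_smul]; exact zero_mem _)
      (fun a b ha hb => by rw [add_smul]; exact add_mem ha hb) r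
    exact fun i r hr => AddSubgroup.mem_iSup_of_mem (i + n) (smul_mem_homDeg M N hr hφ)

theorem homDeg_le (n : ℤ) {φ : M.carrier →ₗ[R] N.carrier} (hφ : φ ∈ homDeg M N n) :
    φ ∈ homBullet M N :=
  AddSubgroup.mem_iSup_of_mem (S := homDeg M N) n hφ

theorem homBullet_induction {C : homBullet M N → Prop}
    (mem : ∀ n, ∀ φ : homBullet M N, φ.1 ∈ homDeg M N n → C φ) (zero : C 0)
    (add : ∀ x y, C x → C y → C (x + y)) (φ : homBullet M N) : C φ := by
  obtain ⟨φ, hφ⟩ := φ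
  refine AddSubgroup.iSup_induction' (homDeg M N)
    (C := fun φ hφ => C ⟨φ, hφ⟩) (fun n φ h => mem n ⟨φ, homDeg_le M N n h⟩ h) zero
    (fun x y hx hy => add ⟨x, hx⟩ ⟨y, hy⟩) hφ

/-- The graded `R`-module `Hom^•(M, N) = ⨁ Hom^n(M, N)`. -/
def hom : GrMod 𝒜 where
  carrier := homBullet M N
  deg n := (homDeg M N n).comap (homBullet M N).subtype.toAddMonoidHom
  isInternal := by
    refine isInternal_of_detect (X := N.carrier) _ ?_ ?_
    · refine eq_top_iff.2 fun φ _ => homBullet_induction M N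
        (C := fun φ => φ ∈ ⨆ n, (homDeg M N n).comap (homBullet M N).subtype.toAddMonoidHom) (fun n φ hφ => AddSubgroup.mem_iSup_of_mem n hφ) (zero_mem _)
        (fun x y hx hy => add_mem hx hy) φ
    · intro k φ hφ hne
      by_contra hcon
      push Not at hcon
      refine hne (Subtype.ext (LinearMap.toAddMonoidHom_injective
        (hom_ext_of_isInternal M.isInternal fun n m hm => ?_)))
      by_contra hm0
      obtain ⟨i, hik, ψ, hψ, hψ0⟩ := hcon
        ((homogProj N.isInternal (k + n)).comp
          (((LinearMap.applyₗ m).comp (homBullet M N).subtype).toAddMonoidHom))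
        (by
          change homogProj N.isInternal (k + n) (φ.1 m) ≠ 0
          rw [homogProj_same N.isInternal (m := φ.1 m) (hφ n m hm)]
          exact hm0)
      refine hψ0 (homogProj_ne N.isInternal (hψ n m hm) fun h => hik (by omega))
  smul_mem hr hφ := smul_mem_homDeg M N hr hφ

/-- The graded dual `M^∨ = Hom^•(M, R)`. -/
def dual : GrMod 𝒜 := hom M (GrMod.ring 𝒜)

/-- The natural map `M → M^∨∨`, `m ↦ (φ ↦ φ m)`. -/
def eval : M.carrier →ₗ[R] M.dual.dual.carrier :=
  LinearMap.codRestrict (homBullet M.dual (GrMod.ring 𝒜))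
    ((homBullet M (GrMod.ring 𝒜)).subtype.flip) (by
      refine homog_induction M.deg (iSup_eq_top_of_isInternal M.isInternal)
        (C := fun m => (homBullet M (GrMod.ring 𝒜)).subtype.flip m ∈
          homBullet M.dual (GrMod.ring 𝒜)) ?_ (by rw [map_zero]; exact zero_mem _)
        (fun x y hx hy => by rw [map_add]; exact add_mem hx hy)
      intro n m hm
      refine homDeg_le M.dual (GrMod.ring 𝒜) n fun i φ hφ => ?_
      rw [add_comm]
      exact hφ n m hm)

/-- `M` is reflexive: the natural map `M → M^∨∨` is an isomorphism. -/
def IsReflexive : Prop := Function.Bijective M.eval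

end GrMod

namespace GrBimod

variable (M N : GrBimod 𝒜)

/-- `Hom^n_{R-bim}(M, N)`: the bimodule homomorphisms of degree `n`. -/
def homDeg (n : ℤ) : AddSubgroup (M.carrier →+ N.carrier) where
  carrier := {φ | (∀ r m, φ (M.left r m) = N.left r (φ m)) ∧
    (∀ r m, φ (M.right r m) = N.right r (φ m)) ∧ ∀ i, ∀ m ∈ M.deg i, φ m ∈ N.deg (n + i)}
  zero_mem' := ⟨fun r _ => (map_zero (N.left r)).symm, fun r _ => (map_zero (N.right r)).symm,
    fun _ _ _ => zero_mem (N.deg _)⟩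
  add_mem' := fun {a b} ha hb => by
    refine ⟨fun r m => ?_, fun r m => ?_, fun i m hm => add_mem (ha.2.2 i m hm) (hb.2.2 i m hm)⟩
    · rw [AddMonoidHom.add_apply, AddMonoidHom.add_apply, ha.1, hb.1, map_add]
    · rw [AddMonoidHom.add_apply, AddMonoidHom.add_apply, ha.2.1, hb.2.1, map_add]
  neg_mem' := fun {a} ha => by
    refine ⟨fun r m => ?_, fun r m => ?_, fun i m hm => neg_mem (ha.2.2 i m hm)⟩
    · rw [AddMonoidHom.neg_apply, AddMonoidHom.neg_apply, ha.1, map_neg]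
    · rw [AddMonoidHom.neg_apply, AddMonoidHom.neg_apply, ha.2.1, map_neg]

/-- `Hom^•_{R-bim}(M, N)`: the sum of all `Hom^n_{R-bim}(M, N)`. -/
def homBullet : AddSubgroup (M.carrier →+ N.carrier) := ⨆ n, homDeg M N n

variable {M N} in
theorem act_comm (act : R →+* AddMonoid.End N.carrier) (r s : R) (m : N.carrier) :
    act r (act s m) = act s (act r m) :=
  DFunLike.congr_fun ((Commute.all r s).map act).eq m

/-- Post-composition `(f, φ) ↦ f ∘ φ`, as a biadditive map. -/
def postComp : AddMonoid.End N.carrier →+ (M.carrier →+ N.carrier) →+ (M.carrier →+ N.carrier) :=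
  AddMonoidHom.compHom

theorem left_mem_homDeg {i n : ℤ} {r : R} {φ : M.carrier →+ N.carrier} (hr : r ∈ 𝒜 i)
    (hφ : φ ∈ homDeg M N n) : postComp M N (N.left r) φ ∈ homDeg M N (i + n) := by
  refine ⟨fun s m => ?_, fun s m => ?_, fun k m hm => ?_⟩
  · change N.left r (φ (M.left s m)) = N.left s (N.left r (φ m))
    rw [hφ.1, act_comm]
  · change N.left r (φ (M.right s m)) = N.right s (N.left r (φ m))
    rw [hφ.2.1, N.comm]
  · rw [add_assoc]
    exact N.left_mem hr (hφ.2.2 k m hm)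

theorem right_mem_homDeg {i n : ℤ} {r : R} {φ : M.carrier →+ N.carrier} (hr : r ∈ 𝒜 i)
    (hφ : φ ∈ homDeg M N n) : postComp M N (N.right r) φ ∈ homDeg M N (i + n) := by
  refine ⟨fun s m => ?_, fun s m => ?_, fun k m hm => ?_⟩
  · change N.right r (φ (M.left s m)) = N.left s (N.right r (φ m))
    rw [hφ.1, N.comm]
  · change N.right r (φ (M.right s m)) = N.right s (N.right r (φ m))
    rw [hφ.2.1, act_comm]
  · rw [add_assoc]
    exact N.right_mem hr (hφ.2.2 k m hm)

theorem comp_mem_homBullet {act : R →+* AddMonoid.End N.carrier}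
    (hact : ∀ {i n : ℤ} {r : R} {φ : M.carrier →+ N.carrier}, r ∈ 𝒜 i → φ ∈ homDeg M N n →
      postComp M N (act r) φ ∈ homDeg M N (i + n))
    (r : R) {φ : M.carrier →+ N.carrier} (hφ : φ ∈ homBullet M N) :
    postComp M N (act r) φ ∈ homBullet M N := by
  refine AddSubgroup.iSup_induction _ (C := fun φ => postComp M N (act r) φ ∈ homBullet M N) hφ ?_
    (by rw [map_zero]; exact zero_mem _)
    (fun a b ha hb => by rw [map_add]; exact add_mem ha hb)
  intro n φ hφ
  refine homog_induction 𝒜 (iSup_eq_top_of_isInternal (isInternal_ring 𝒜))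
    (C := fun r => postComp M N (act r) φ ∈ homBullet M N) ?_
    (by rw [map_zero, map_zero]; exact zero_mem _)
    (fun a b ha hb => by rw [map_add, map_add]; exact add_mem ha hb) r
  exact fun i r hr => AddSubgroup.mem_iSup_of_mem (i + n) (hact hr hφ)

/-- Post-composition with an action of `R` on `N`, as an action of `R` on `Hom^•(M, N)`. -/
def homAction (act : R →+* AddMonoid.End N.carrier)
    (hact : ∀ {i n : ℤ} {r : R} {φ : M.carrier →+ N.carrier}, r ∈ 𝒜 i → φ ∈ homDeg M N n →
      postComp M N (act r) φ ∈ homDeg M N (i + n)) :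
    R →+* AddMonoid.End (homBullet M N) where
  toFun r :=
    { toFun := fun φ => ⟨postComp M N (act r) φ.1, comp_mem_homBullet M N hact r φ.2⟩
      map_zero' := Subtype.ext (map_zero (postComp M N (act r)))
      map_add' := fun a b => Subtype.ext (map_add (postComp M N (act r)) _ _) }
  map_one' := by ext φ m; exact congrArg (fun f => f (φ.1 m)) (map_one act)
  map_mul' a b := by ext φ m; exact congrArg (fun f => f (φ.1 m)) (map_mul act a b)
  map_zero' := by ext φ m; exact congrArg (fun f => f (φ.1 m)) (map_zero act)
  map_add' a b := by ext φ m; exact congrArg (fun f => f (φ.1 m)) (map_add act a b)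

theorem homBullet_induction {C : homBullet M N → Prop}
    (mem : ∀ n, ∀ φ : homBullet M N, φ.1 ∈ homDeg M N n → C φ) (zero : C 0)
    (add : ∀ x y, C x → C y → C (x + y)) (φ : homBullet M N) : C φ := by
  obtain ⟨φ, hφ⟩ := φ
  exact AddSubgroup.iSup_induction' (homDeg M N)
    (C := fun φ hφ => C ⟨φ, hφ⟩)
    (fun n φ h => mem n ⟨φ, AddSubgroup.mem_iSup_of_mem (S := homDeg M N) n h⟩ h) zero
    (fun x y hx hy => add ⟨x, hx⟩ ⟨y, hy⟩) hφ

/-- The graded `R`-bimodule `Hom^•_{R-bim}(M, N) = ⨁ Hom^n_{R-bim}(M, N)` with the actions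
`(r φ)(m) = r φ(m)` and `(φ r)(m) = φ(m) r`. -/
def hom : GrBimod 𝒜 where
  carrier := homBullet M N
  left := homAction M N N.left (left_mem_homDeg M N)
  right := homAction M N N.right (right_mem_homDeg M N)
  comm r s φ := by ext m; exact N.comm r s (φ.1 m)
  deg n := (homDeg M N n).comap (homBullet M N).subtype
  isInternal := by
    refine isInternal_of_detect (X := N.carrier) _ ?_ ?_
    · refine eq_top_iff.2 fun φ _ => homBullet_induction M N
        (C := fun φ => φ ∈ ⨆ n, (homDeg M N n).comap (homBullet M N).subtype) (fun n φ hφ => AddSubgroup.mem_iSup_of_mem n hφ) (zero_mem _)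
        (fun x y hx hy => add_mem hx hy) φ
    · intro k φ hφ hne
      by_contra hcon
      push Not at hcon
      refine hne (Subtype.ext (hom_ext_of_isInternal M.isInternal fun n m hm => ?_))
      by_contra hm0
      obtain ⟨i, hik, ψ, hψ, hψ0⟩ := hcon
        ((homogProj N.isInternal (k + n)).comp
          ((AddMonoidHom.eval m).comp (homBullet M N).subtype))
        (by
          change homogProj N.isInternal (k + n) (φ.1 m) ≠ 0
          rw [homogProj_same N.isInternal (m := φ.1 m) (hφ.2.2 n m hm)]
          exact hm0)
      refine hψ0 (homogProj_ne N.isInternal (hψ.2.2 n m hm) fun h => hik (by omega))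
  left_mem hr hφ := left_mem_homDeg M N hr hφ
  right_mem hr hφ := right_mem_homDeg M N hr hφ

end GrBimod

end Hom

section Constructions

variable {𝒜 : ℤ → AddSubgroup R} [hR : GradedRing 𝒜]

namespace GrBimod

/-- The twisted bimodule: `R` with the actions `left r m = r m` and `right r m = m f(r)`. -/
def twist (f : R →+* R) (hf : ∀ n, ∀ r ∈ 𝒜 n, f r ∈ 𝒜 n) : GrBimod 𝒜 where
  carrier := R
  left := Module.toAddMonoidEnd R R
  right := (Module.toAddMonoidEnd R R).comp f
  comm r s m := mul_left_comm r (f s) m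
  deg := 𝒜
  isInternal := isInternal_ring 𝒜
  left_mem hr hm := SetLike.mul_mem_graded hr hm
  right_mem hr hm := SetLike.mul_mem_graded (hf _ _ hr) hm

variable (M N : GrBimod 𝒜) (A : Subring R)

/-- `M` as a module over a subring `A` of `R` acting from the right. -/
def AsRight (_A : Subring R) : Type u := M.carrier

/-- `N` as a module over a subring `A` of `R` acting from the left. -/
def AsLeft (_A : Subring R) : Type u := N.carrier

instance : AddCommGroup (M.AsRight A) := M.addCommGroup
instance : AddCommGroup (N.AsLeft A) := N.addCommGroup
instance : Module A (M.AsRight A) := Module.compHom M.carrier (M.right.comp A.subtype)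
instance : Module A (N.AsLeft A) := Module.compHom N.carrier (N.left.comp A.subtype)

/-- The underlying abelian group of `M ⊗_A N`, where `(m a) ⊗ n = m ⊗ (a n)` for `a ∈ A`. -/
abbrev TensorCarrier : Type u := M.AsRight A ⊗[A] N.AsLeft A

/-- The biadditive map `(m, n) ↦ m ⊗ n`. -/
def tm : M.carrier →+ N.carrier →+ TensorCarrier M N A where
  toFun m :=
    { toFun := fun n => TensorProduct.tmul A (M := M.AsRight A) (N := N.AsLeft A) m n
      map_zero' := TensorProduct.tmul_zero (R := A) (M := M.AsRight A) (N := N.AsLeft A) m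
      map_add' := TensorProduct.tmul_add (R := A) (M := M.AsRight A) (N := N.AsLeft A) m }
  map_zero' := AddMonoidHom.ext
    (TensorProduct.zero_tmul (R := A) (M.AsRight A) (N := N.AsLeft A))
  map_add' a b := AddMonoidHom.ext
    (TensorProduct.add_tmul (R := A) (M := M.AsRight A) (N := N.AsLeft A) a b)

theorem tm_balanced (a : A) (m : M.carrier) (n : N.carrier) :
    tm M N A (M.right a m) n = tm M N A m (N.left a n) :=
  TensorProduct.smul_tmul (R := A) (R' := A) (M := M.AsRight A) (N := N.AsLeft A) a m n

theorem tensor_induction {C : TensorCarrier M N A → Prop} (zero : C 0)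
    (tmul : ∀ m n, C (tm M N A m n)) (add : ∀ x y, C x → C y → C (x + y))
    (x : TensorCarrier M N A) : C x :=
  TensorProduct.induction_on x zero tmul add

/-- The additive map out of `M ⊗_A N` given by a balanced biadditive map. -/
def tensorLift {P : Type u} [AddCommGroup P] (F : M.carrier →+ N.carrier →+ P)
    (hF : ∀ (a : A) m n, F (M.right a m) n = F m (N.left a n)) : TensorCarrier M N A →+ P :=
  TensorProduct.liftAddHom (M := M.AsRight A) (N := N.AsLeft A) F hF

theorem tensorLift_tm {P : Type u} [AddCommGroup P] (F : M.carrier →+ N.carrier →+ P)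
    (hF : ∀ (a : A) m n, F (M.right a m) n = F m (N.left a n)) (m : M.carrier) (n : N.carrier) :
    tensorLift M N A F hF (tm M N A m n) = F m n := rfl

theorem tensor_ext {f g : AddMonoid.End (TensorCarrier M N A)}
    (h : ∀ m n, f (tm M N A m n) = g (tm M N A m n)) : f = g :=
  AddMonoidHom.ext fun x => tensor_induction M N A (C := fun x => f x = g x)
    ((map_zero f).trans (map_zero g).symm) h
    (fun x y hx hy => by rw [map_add, map_add, hx, hy]) x

/-- The action `r (m ⊗ n) = (r m) ⊗ n`. -/
def tensorLeft : R →+* AddMonoid.End (TensorCarrier M N A) where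
  toFun r := tensorLift M N A ((tm M N A).comp (M.left r)) fun a m n => by
    change tm M N A (M.left r (M.right a m)) n = tm M N A (M.left r m) (N.left a n)
    rw [M.comm, tm_balanced]
  map_one' := tensor_ext M N A fun m n => by
    change tm M N A (M.left 1 m) n = tm M N A m n
    rw [map_one]; rfl
  map_mul' r s := tensor_ext M N A fun m n => by
    change tm M N A (M.left (r * s) m) n = tm M N A (M.left r (M.left s m)) n
    rw [map_mul]; rfl
  map_zero' := tensor_ext M N A fun m n => by
    change tm M N A (M.left 0 m) n = 0
    rw [map_zero]
    exact DFunLike.congr_fun (map_zero (tm M N A)) n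
  map_add' r s := tensor_ext M N A fun m n => by
    change tm M N A (M.left (r + s) m) n = tm M N A (M.left r m) n + tm M N A (M.left s m) n
    rw [map_add]
    exact DFunLike.congr_fun (map_add (tm M N A) (M.left r m) (M.left s m)) n

/-- The action `(m ⊗ n) r = m ⊗ (n r)`. -/
def tensorRight : R →+* AddMonoid.End (TensorCarrier M N A) where
  toFun r := tensorLift M N A ((tm M N A).compl₂ (N.right r)) fun a m n => by
    change tm M N A (M.right a m) (N.right r n) = tm M N A m (N.right r (N.left a n))
    rw [← N.comm, tm_balanced]
  map_one' := tensor_ext M N A fun m n => by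
    change tm M N A m (N.right 1 n) = tm M N A m n
    rw [map_one]; rfl
  map_mul' r s := tensor_ext M N A fun m n => by
    change tm M N A m (N.right (r * s) n) = tm M N A m (N.right r (N.right s n))
    rw [map_mul]; rfl
  map_zero' := tensor_ext M N A fun m n => by
    change tm M N A m (N.right 0 n) = 0
    rw [map_zero]
    exact map_zero (tm M N A m)
  map_add' r s := tensor_ext M N A fun m n => by
    change tm M N A m (N.right (r + s) n) = tm M N A m (N.right r n) + tm M N A m (N.right s n)
    rw [map_add]
    exact map_add (tm M N A m) (N.right r n) (N.right s n)

/-- The component of degree `k` of `M ⊗_A N` is generated by the tensors `m ⊗ n` of homogeneous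
elements with `deg m + deg n = k`. -/
def tensorDeg (k : ℤ) : AddSubgroup (TensorCarrier M N A) :=
  AddSubgroup.closure {x | ∃ (i j : ℤ) (m : M.carrier) (n : N.carrier),
    i + j = k ∧ m ∈ M.deg i ∧ n ∈ N.deg j ∧ x = tm M N A m n}

theorem tm_mem_tensorDeg {i j : ℤ} {m : M.carrier} {n : N.carrier}
    (hm : m ∈ M.deg i) (hn : n ∈ N.deg j) : tm M N A m n ∈ tensorDeg M N A (i + j) :=
  AddSubgroup.subset_closure ⟨i, j, m, n, rfl, hm, hn, rfl⟩

theorem iSup_tensorDeg : ⨆ k, tensorDeg M N A k = ⊤ := by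
  refine eq_top_iff.2 fun x _ => ?_
  refine tensor_induction M N A (C := fun x => x ∈ ⨆ k, tensorDeg M N A k) (zero_mem _) ?_
    (fun x y hx hy => add_mem hx hy) x
  intro m n
  refine homog_induction M.deg (iSup_eq_top_of_isInternal M.isInternal)
    (C := fun m => tm M N A m n ∈ ⨆ k, tensorDeg M N A k) ?_
    (by rw [map_zero]; exact zero_mem _)
    (fun a b ha hb => by rw [map_add]; exact add_mem ha hb) m
  intro i m hm
  refine homog_induction N.deg (iSup_eq_top_of_isInternal N.isInternal)
    (C := fun n => tm M N A m n ∈ ⨆ k, tensorDeg M N A k) ?_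
    (by rw [map_zero]; exact zero_mem _)
    (fun a b ha hb => by rw [map_add]; exact add_mem ha hb) n
  intro j n hn
  exact AddSubgroup.mem_iSup_of_mem (i + j) (tm_mem_tensorDeg M N A hm hn)

/-- The biadditive map `(m, n) ↦ ∑ i, mᵢ ⊗ n_{k-i}`. -/
def tensorProjAux (k : ℤ) : M.carrier →+ N.carrier →+ TensorCarrier M N A :=
  letI := M.isInternal.chooseDecomposition
  (DirectSum.toAddMonoid fun i : ℤ =>
    ((tm M N A).compl₂ (homogProj N.isInternal (k - i))).comp (M.deg i).subtype).comp
    (DirectSum.decomposeAddEquiv M.deg).toAddMonoidHom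

theorem tensorProjAux_apply (k : ℤ) {i : ℤ} {m : M.carrier} (hm : m ∈ M.deg i) (n : N.carrier) :
    tensorProjAux M N A k m n = tm M N A m (homogProj N.isInternal (k - i) n) := by
  let _ := M.isInternal.chooseDecomposition
  have h := DirectSum.decompose_of_mem M.deg hm
  have h' : tensorProjAux M N A k m = (DirectSum.toAddMonoid fun i : ℤ =>
    ((tm M N A).compl₂ (homogProj N.isInternal (k - i))).comp (M.deg i).subtype)
      (DirectSum.decompose M.deg m) := rfl
  rw [h', h, DirectSum.toAddMonoid_of]
  rfl

theorem homogProj_left {i k : ℤ} {r : R} (hr : r ∈ 𝒜 i) (n : N.carrier) :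
    homogProj N.isInternal (i + k) (N.left r n) = N.left r (homogProj N.isInternal k n) := by
  refine homog_induction N.deg (iSup_eq_top_of_isInternal N.isInternal)
    (C := fun n => homogProj N.isInternal (i + k) (N.left r n) =
      N.left r (homogProj N.isInternal k n)) ?_ (by simp only [map_zero])
    (fun a b ha hb => by simp only [map_add, ha, hb]) n
  intro j n hn
  by_cases hjk : j = k
  · subst hjk
    rw [homogProj_same _ hn, homogProj_same _ (N.left_mem hr hn)]
  · rw [homogProj_ne _ hn hjk, homogProj_ne _ (N.left_mem hr hn) (by omega), map_zero]

/-- The projection of `M ⊗_A N` to its component of degree `k`, for a graded subring `A`. -/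
def tensorProj (hA : ∀ a ∈ A, ∀ n, homogProj (isInternal_ring 𝒜) n a ∈ A) (k : ℤ) :
    TensorCarrier M N A →+ TensorCarrier M N A :=
  tensorLift M N A (tensorProjAux M N A k) (by
    intro a m n
    refine homog_induction M.deg (iSup_eq_top_of_isInternal M.isInternal)
      (C := fun m => tensorProjAux M N A k (M.right a m) n =
        tensorProjAux M N A k m (N.left a n)) ?_
      (by simp only [map_zero, AddMonoidHom.zero_apply])
      (fun a b ha hb => by simp only [map_add, AddMonoidHom.add_apply, ha, hb]) m
    intro i m hm
    have key : ∀ j, ∀ b : A, (b : R) ∈ 𝒜 j → tensorProjAux M N A k (M.right b m) n =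
        tensorProjAux M N A k m (N.left b n) := by
      intro j b hb
      rw [tensorProjAux_apply M N A k (M.right_mem hb hm), tensorProjAux_apply M N A k hm,
        show k - i = j + (k - (j + i)) by ring, homogProj_left N hb, tm_balanced]
    let f : R →+ TensorCarrier M N A := ((AddMonoidHom.eval n).comp (tensorProjAux M N A k)).comp
      ((AddMonoidHom.eval m).comp M.right.toAddMonoidHom)
    let g : R →+ TensorCarrier M N A := (tensorProjAux M N A k m).comp
      ((AddMonoidHom.eval n).comp N.left.toAddMonoidHom)
    change f a = g a
    classical
    let _ := (isInternal_ring 𝒜).chooseDecomposition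
    rw [← DirectSum.sum_support_decompose 𝒜 (a : R), map_sum, map_sum]
    refine Finset.sum_congr rfl fun j _ => key j ⟨_, hA a a.2 j⟩ ?_
    exact SetLike.coe_mem (DirectSum.decompose 𝒜 (a : R) j))

theorem tensorProj_same (hA : ∀ a ∈ A, ∀ n, homogProj (isInternal_ring 𝒜) n a ∈ A) {k : ℤ}
    {x : TensorCarrier M N A} (hx : x ∈ tensorDeg M N A k) : tensorProj M N A hA k x = x := by
  induction hx using AddSubgroup.closure_induction with
  | zero => exact map_zero _
  | add x y _ _ hx hy => rw [map_add, hx, hy]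
  | neg x _ hx => rw [map_neg, hx]
  | mem x hx =>
    obtain ⟨i, j, m, n, rfl, hm, hn, rfl⟩ := hx
    change tensorProjAux M N A (i + j) m n = _
    rw [tensorProjAux_apply M N A _ hm, add_sub_cancel_left, homogProj_same _ hn]

theorem tensorProj_ne (hA : ∀ a ∈ A, ∀ n, homogProj (isInternal_ring 𝒜) n a ∈ A) {k l : ℤ}
    (hkl : k ≠ l) {x : TensorCarrier M N A} (hx : x ∈ tensorDeg M N A k) :
    tensorProj M N A hA l x = 0 := by
  induction hx using AddSubgroup.closure_induction with
  | zero => exact map_zero _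
  | add x y _ _ hx hy => rw [map_add, hx, hy, add_zero]
  | neg x _ hx => rw [map_neg, hx, neg_zero]
  | mem x hx =>
    obtain ⟨i, j, m, n, rfl, hm, hn, rfl⟩ := hx
    change tensorProjAux M N A l m n = _
    rw [tensorProjAux_apply M N A _ hm, homogProj_ne _ hn (by omega)]
    exact map_zero _

/-- The tensor product `M ⊗_A N` of graded `R`-bimodules over a graded subring `A` of `R`. -/
def tensor (hA : ∀ a ∈ A, ∀ n, homogProj (isInternal_ring 𝒜) n a ∈ A) : GrBimod 𝒜 where
  carrier := TensorCarrier M N A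
  left := tensorLeft M N A
  right := tensorRight M N A
  comm r s x := DFunLike.congr_fun (tensor_ext M N A
    (f := (tensorLeft M N A r) * (tensorRight M N A s))
    (g := (tensorRight M N A s) * (tensorLeft M N A r)) fun _ _ => rfl) x
  deg := tensorDeg M N A
  isInternal := isInternal_of_detect _ (iSup_tensorDeg M N A) fun k x hx hne =>
    ⟨tensorProj M N A hA k, by rwa [tensorProj_same M N A hA hx],
      fun _ hi _ hy => tensorProj_ne M N A hA hi hy⟩
  left_mem {i j r x} hr hx := by
    induction hx using AddSubgroup.closure_induction with
    | zero => rw [map_zero]; exact zero_mem _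
    | add x y _ _ hx hy => rw [map_add]; exact add_mem hx hy
    | neg x _ hx => rw [map_neg]; exact neg_mem hx
    | mem x hx =>
      obtain ⟨a, b, m, n, rfl, hm, hn, rfl⟩ := hx
      rw [← add_assoc]
      exact tm_mem_tensorDeg M N A (M.left_mem hr hm) hn
  right_mem {i j r x} hr hx := by
    induction hx using AddSubgroup.closure_induction with
    | zero => rw [map_zero]; exact zero_mem _
    | add x y _ _ hx hy => rw [map_add]; exact add_mem hx hy
    | neg x _ hx => rw [map_neg]; exact neg_mem hx
    | mem x hx =>
      obtain ⟨a, b, m, n, rfl, hm, hn, rfl⟩ := hx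
      rw [add_left_comm]
      exact tm_mem_tensorDeg M N A hm (N.right_mem hr hn)

/-- The tensor product `M ⊗_R N`. -/
def tensorR : GrBimod 𝒜 := tensor M N ⊤ fun _ _ _ => Subring.mem_top _

end GrBimod

/-- The invariants of a grading-preserving ring endomorphism form a graded subring. -/
theorem homogProj_mem_eqLocus (f : R →+* R) (hf : ∀ n, ∀ r ∈ 𝒜 n, f r ∈ 𝒜 n) (a : R)
    (ha : a ∈ f.eqLocus (RingHom.id R)) (n : ℤ) :
    homogProj (isInternal_ring 𝒜) n a ∈ f.eqLocus (RingHom.id R) := by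
  have key : (homogProj (isInternal_ring 𝒜) n).comp f.toAddMonoidHom =
      f.toAddMonoidHom.comp (homogProj (isInternal_ring 𝒜) n) := by
    refine hom_ext_of_isInternal (isInternal_ring 𝒜) fun i r hr => ?_
    change homogProj _ n (f r) = f (homogProj _ n r)
    by_cases hin : i = n
    · subst hin
      rw [homogProj_same _ hr, homogProj_same _ (hf _ _ hr)]
    · rw [homogProj_ne _ hr hin, homogProj_ne _ (hf _ _ hr) hin, map_zero]
  have ha' : f a = a := ha
  have := DFunLike.congr_fun key a
  change homogProj _ n (f a) = f (homogProj _ n a) at this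
  rw [ha'] at this
  exact this.symm

end Constructions

end Graded

section Coxeter

open LaurentPolynomial

universe v w b

section Sym

variable {k : Type u} {V : Type v} {W : Type w} [Field k] [AddCommGroup V] [Module k V] [Group W]

variable (k V) in
/-- The homogeneous polynomials of polynomial degree `d` in `Sym(V)`; their degree in the grading
where the elements of `V` have degree `2` is `2 d`. -/
def symDeg (d : ℕ) : Submodule k (SymmetricAlgebra k V) :=
  LinearMap.range (SymmetricAlgebra.ι k V) ^ d

/-- The action of `w` on `Sym(V)` by algebra automorphisms that extends the action on `V`. -/
def symAct (ρ : Representation k W V) (w : W) : SymmetricAlgebra k V →ₐ[k] SymmetricAlgebra k V :=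
  SymmetricAlgebra.lift (SymmetricAlgebra.ι k V ∘ₗ ρ w)

theorem symAct_mem (ρ : Representation k W V) (w : W) {d : ℕ} {a : SymmetricAlgebra k V}
    (ha : a ∈ symDeg k V d) : symAct ρ w a ∈ symDeg k V d := by
  have h : (symDeg k V d).map (symAct ρ w).toLinearMap ≤ symDeg k V d := by
    rw [symDeg, Submodule.map_pow]
    refine pow_le_pow_left' ?_ d
    rintro _ ⟨_, ⟨v, rfl⟩, rfl⟩
    exact ⟨ρ w v, by simp [symAct]⟩
  exact h ⟨a, ha, rfl⟩

theorem one_mem_symDeg : (1 : SymmetricAlgebra k V) ∈ symDeg k V 0 := by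
  rw [symDeg, pow_zero]
  exact Submodule.one_le.1 le_rfl

theorem mul_mem_symDeg {d e : ℕ} {a c : SymmetricAlgebra k V} (ha : a ∈ symDeg k V d)
    (hc : c ∈ symDeg k V e) : a * c ∈ symDeg k V (d + e) := by
  rw [symDeg, pow_add]
  exact Submodule.mul_mem_mul ha hc

theorem mem_iSup_symDeg (a : SymmetricAlgebra k V) : a ∈ ⨆ d, symDeg k V d := by
  induction a using SymmetricAlgebra.induction with
  | algebraMap r =>
    rw [Algebra.algebraMap_eq_smul_one]
    exact Submodule.mem_iSup_of_mem 0 (Submodule.smul_mem _ r one_mem_symDeg)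
  | ι x =>
    refine Submodule.mem_iSup_of_mem 1 ?_
    rw [symDeg, pow_one]
    exact ⟨x, rfl⟩
  | mul a c ha hc =>
    refine Submodule.iSup_induction _ (motive := fun a => a * c ∈ ⨆ d, symDeg k V d) ha ?_
      (by rw [zero_mul]; exact zero_mem _)
      (fun x y hx hy => by rw [add_mul]; exact add_mem hx hy)
    intro d a ha
    refine Submodule.iSup_induction _ (motive := fun c => a * c ∈ ⨆ d, symDeg k V d) hc ?_
      (by rw [mul_zero]; exact zero_mem _)
      (fun x y hx hy => by rw [mul_add]; exact add_mem hx hy)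
    exact fun e c hc => Submodule.mem_iSup_of_mem (d + e) (mul_mem_symDeg ha hc)
  | add a b ha hb => exact add_mem ha hb

/-- The algebra homomorphism `Sym(V) → Sym(V)[T, T⁻¹]` with `v ↦ v T²`. -/
def symCoaction : SymmetricAlgebra k V →ₐ[k] LaurentPolynomial (SymmetricAlgebra k V) :=
  SymmetricAlgebra.lift
    { toFun := fun v => AddMonoidAlgebra.single 2 (SymmetricAlgebra.ι k V v)
      map_add' := fun a b => by rw [map_add, AddMonoidAlgebra.single_add]
      map_smul' := fun c a => by rw [map_smul, AddMonoidAlgebra.smul_single]; rfl }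

theorem symCoaction_of_mem {d : ℕ} {a : SymmetricAlgebra k V} (ha : a ∈ symDeg k V d) :
    symCoaction a = AddMonoidAlgebra.single (2 * d : ℤ) a := by
  induction ha using Submodule.pow_induction_on_left' with
  | algebraMap r => rw [AlgHom.commutes]; rfl
  | add x y i _ _ hx hy => rw [map_add, hx, hy, AddMonoidAlgebra.single_add]
  | mem_mul m hm i x _ hx =>
    obtain ⟨v, rfl⟩ := hm
    rw [map_mul, hx, symCoaction, SymmetricAlgebra.lift_ι_apply]
    change AddMonoidAlgebra.single 2 _ * AddMonoidAlgebra.single _ _ = _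
    rw [AddMonoidAlgebra.single_mul_single]
    congr 1
    push_cast
    ring

/-- `α` is a root of `t`: there is a coroot `f` with `f(α) = 2` such that `t v = v - f(v) α`. -/
def IsRoot (ρ : Representation k W V) (t : W) (α : V) : Prop :=
  ∃ f : Module.Dual k V, f α = 2 ∧ ∀ v, ρ t v = v - f v • α

end Sym

variable {B : Type b} {W : Type w} [Group W] {M : CoxeterMatrix B} (cs : CoxeterSystem M W)
  (k : Type u) (V : Type v) [Field k] [AddCommGroup V] [Module k V]

/-- A faithful representation `V` of the Coxeter group `W` over `k` such that the simple
reflections act by reflections and the GKM condition holds (reflections with proportional roots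
coincide), and a `W`-invariant multiplicative set `σ ⊆ Sym(V)` of nonzero homogeneous elements
that are not divisible by any root. -/
structure ReflectionData where
  ρ : Representation k W V
  faithful : Function.Injective ρ
  exists_root : ∀ i, ∃ α, IsRoot ρ (cs.simple i) α
  gkm : ∀ t t', cs.IsReflection t → cs.IsReflection t' → ∀ α β, IsRoot ρ t α → IsRoot ρ t' β →
    (∃ c : k, c ≠ 0 ∧ α = c • β) → t = t'
  σ : Submonoid (SymmetricAlgebra k V)
  σ_ne_zero : ∀ s ∈ σ, s ≠ 0
  σ_homogeneous : ∀ s ∈ σ, ∃ d, s ∈ symDeg k V d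
  σ_invariant : ∀ w, ∀ s ∈ σ, symAct ρ w s ∈ σ
  σ_root : ∀ t, cs.IsReflection t → ∀ α, IsRoot ρ t α → ∀ s ∈ σ, ¬ SymmetricAlgebra.ι k V α ∣ s

namespace ReflectionData

variable {cs k V} (D : ReflectionData cs k V)

/-- The ring `R = σ⁻¹ Sym(V)`. -/
def R : Type (max u v) := Localization D.σ

instance : CommRing D.R := inferInstanceAs (CommRing (Localization D.σ))
instance : Algebra (SymmetricAlgebra k V) D.R :=
  inferInstanceAs (Algebra (SymmetricAlgebra k V) (Localization D.σ))
instance : IsLocalization D.σ D.R :=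
  inferInstanceAs (IsLocalization D.σ (Localization D.σ))

theorem le_comap_symAct (w : W) : D.σ ≤ D.σ.comap (symAct D.ρ w).toRingHom := D.σ_invariant w

/-- The action of `w` on `R`. -/
def act (w : W) : D.R →+* D.R :=
  IsLocalization.map D.R (symAct D.ρ w).toRingHom (D.le_comap_symAct w)

/-- The component of degree `n` of `R`: it consists of the fractions `a / s` where `a` is
homogeneous of degree `2 d`, `s ∈ σ` is homogeneous of degree `2 e` and `n = 2 d - 2 e`. -/
def deg (n : ℤ) : AddSubgroup D.R :=
  AddSubgroup.closure {x | ∃ (d e : ℕ) (a : SymmetricAlgebra k V) (s : D.σ),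
    a ∈ symDeg k V d ∧ (s : SymmetricAlgebra k V) ∈ symDeg k V e ∧ n = 2 * d - 2 * e ∧
      x = IsLocalization.mk' D.R a s}

theorem act_mem (w : W) (n : ℤ) (r : D.R) (hr : r ∈ D.deg n) : D.act w r ∈ D.deg n := by
  induction hr using AddSubgroup.closure_induction with
  | zero => rw [map_zero]; exact zero_mem _
  | add x y _ _ hx hy => rw [map_add]; exact add_mem hx hy
  | neg x _ hx => rw [map_neg]; exact neg_mem hx
  | mem x hx =>
    obtain ⟨d, e, a, s, ha, hs, rfl, rfl⟩ := hx
    rw [act, IsLocalization.map_mk']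
    exact AddSubgroup.subset_closure
      ⟨d, e, _, _, symAct_mem D.ρ w ha, symAct_mem D.ρ w hs, rfl, rfl⟩

/-- The ring homomorphism `R → R[T, T⁻¹]` with `r ↦ r Tⁿ` for `r` of degree `n`. -/
def coaction : D.R →+* LaurentPolynomial D.R :=
  IsLocalization.lift (M := D.σ)
    (g := (AddMonoidAlgebra.mapRingHom ℤ (algebraMap (SymmetricAlgebra k V) D.R)).comp
      symCoaction.toRingHom) (by
    rintro ⟨s, hs⟩
    obtain ⟨d, hd⟩ := D.σ_homogeneous s hs
    change IsUnit (AddMonoidAlgebra.mapRingHom ℤ (algebraMap (SymmetricAlgebra k V) D.R)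
      (symCoaction s))
    rw [symCoaction_of_mem hd, AddMonoidAlgebra.mapRingHom_single, single_eq_C_mul_T]
    exact ((IsLocalization.map_units D.R (⟨s, hs⟩ : D.σ)).map C).mul (isUnit_T _))

theorem coaction_of_mem {n : ℤ} {r : D.R} (hr : r ∈ D.deg n) :
    D.coaction r = AddMonoidAlgebra.single n r := by
  induction hr using AddSubgroup.closure_induction with
  | zero => rw [map_zero, AddMonoidAlgebra.single_zero]
  | add x y _ _ hx hy => rw [map_add, hx, hy, AddMonoidAlgebra.single_add]
  | neg x _ hx => rw [map_neg, hx, AddMonoidAlgebra.single_neg]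
  | mem x hx =>
    obtain ⟨d, e, a, s, ha, hs, rfl, rfl⟩ := hx
    rw [coaction, IsLocalization.lift_mk'_spec]
    change AddMonoidAlgebra.mapRingHom ℤ (algebraMap (SymmetricAlgebra k V) D.R) (symCoaction a) =
      AddMonoidAlgebra.mapRingHom ℤ (algebraMap (SymmetricAlgebra k V) D.R)
        (symCoaction (s : SymmetricAlgebra k V)) * _
    rw [symCoaction_of_mem ha, symCoaction_of_mem hs, AddMonoidAlgebra.mapRingHom_single,
      AddMonoidAlgebra.mapRingHom_single, AddMonoidAlgebra.single_mul_single,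
      IsLocalization.mk'_spec']
    congr 1
    ring

theorem isInternal_deg : DirectSum.IsInternal D.deg := by
  refine isInternal_of_detect (X := D.R) _ (eq_top_iff.2 fun r _ => ?_) fun k x hx hne =>
    ⟨(Finsupp.applyAddHom k).comp
      (AddMonoidAlgebra.coeffAddEquiv.toAddMonoidHom.comp D.coaction.toAddMonoidHom), ?_, ?_⟩
  · obtain ⟨a, s, rfl⟩ := IsLocalization.exists_mk'_eq D.σ r
    obtain ⟨e, he⟩ := D.σ_homogeneous s s.2
    refine Submodule.iSup_induction _ (motive := fun a => IsLocalization.mk' D.R a s ∈ ⨆ n, D.deg n)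
      (mem_iSup_symDeg a) ?_ (by rw [IsLocalization.mk'_zero]; exact zero_mem _)
      (fun x y hx hy => by
        rw [IsLocalization.mk'_eq_mul_mk'_one, map_add, add_mul,
          ← IsLocalization.mk'_eq_mul_mk'_one, ← IsLocalization.mk'_eq_mul_mk'_one]
        exact add_mem hx hy)
    intro d a ha
    exact AddSubgroup.mem_iSup_of_mem (2 * d - 2 * e : ℤ)
      (AddSubgroup.subset_closure ⟨d, e, a, s, ha, he, rfl, rfl⟩)
  · change (D.coaction x).coeff k ≠ 0
    rw [D.coaction_of_mem hx]
    rw [AddMonoidAlgebra.coeff_single, Finsupp.single_eq_same]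
    exact hne
  · intro i hi y hy
    change (D.coaction y).coeff k = 0
    rw [D.coaction_of_mem hy]
    rw [AddMonoidAlgebra.coeff_single]
    exact Finsupp.single_eq_of_ne (Ne.symm hi)

instance gradedRing : GradedRing D.deg where
  one_mem := AddSubgroup.subset_closure ⟨0, 0, 1, 1, one_mem_symDeg, one_mem_symDeg, by simp,
    ((IsLocalization.mk'_one (M := D.σ) D.R (1 : SymmetricAlgebra k V)).trans (map_one _)).symm⟩
  mul_mem {i j x y} hx hy := by
    induction hx using AddSubgroup.closure_induction with
    | zero => rw [zero_mul]; exact zero_mem _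
    | add a b _ _ ha hb => rw [add_mul]; exact add_mem ha hb
    | neg a _ ha => rw [neg_mul]; exact neg_mem ha
    | mem x hx =>
      induction hy using AddSubgroup.closure_induction with
      | zero => rw [mul_zero]; exact zero_mem _
      | add a b _ _ ha hb => rw [mul_add]; exact add_mem ha hb
      | neg a _ ha => rw [mul_neg]; exact neg_mem ha
      | mem y hy =>
        obtain ⟨d, e, a, s, ha, hs, rfl, rfl⟩ := hx
        obtain ⟨d', e', a', s', ha', hs', rfl, rfl⟩ := hy
        rw [← IsLocalization.mk'_mul]
        exact AddSubgroup.subset_closure ⟨d + d', e + e', a * a', s * s', mul_mem_symDeg ha ha',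
          mul_mem_symDeg hs hs', by push_cast; ring, rfl⟩
  toDecomposition := D.isInternal_deg.chooseDecomposition

/-- The graded `R`-bimodule `R`. -/
def unit : GrBimod D.deg := GrBimod.twist (RingHom.id D.R) fun _ _ hr => hr

/-- The standard twisted bimodule `R_w`: `R` with the actions `r · m = r m`, `m · r = m w(r)`. -/
def twisted (w : W) : GrBimod D.deg := GrBimod.twist (D.act w) (D.act_mem w)

/-- The subring `R^t` of `t`-invariants. -/
def invariants (t : W) : Subring D.R := (D.act t).eqLocus (RingHom.id D.R)

/-- The Bott–Samelson bimodule `R(t₁, …, tₙ) = R ⊗_{R^{t₁}} R ⊗_{R^{t₂}} ⋯ ⊗_{R^{tₙ}} R` of a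
reflection expression; it is `R` for the empty expression. -/
def bottSamelson : List {t : W // cs.IsReflection t} → GrBimod D.deg
  | [] => D.unit
  | t :: ts => GrBimod.tensor D.unit (bottSamelson ts) (D.invariants t)
      (homogProj_mem_eqLocus (D.act t) (D.act_mem t))

/-- The bimodule `R_x ⊗_R R(t) ⊗_R R_y`. -/
def twistedBottSamelson (x : W) (t : List {t : W // cs.IsReflection t}) (y : W) :
    GrBimod D.deg :=
  GrBimod.tensorR (GrBimod.tensorR (D.twisted x) (D.bottSamelson t)) (D.twisted y)

end ReflectionData

end Coxeter

end Soergel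

end

/-!
The ring `R` is a domain, and over it the statement reduces to linear algebra over its field of
fractions.

*Finiteness.* A reflection `t` with root `α` moves every element of `R` by a multiple of `α`
(`dvd_sub_act`), so that, `2` being invertible, `R = R^t ⊕ R^t α` with homogeneous coordinates
(`nonempty_dualBasis_eqLocus`). Inductively, the twisted Bott–Samelson bimodules have finite
homogeneous dual bases both as left and as right modules (`HasDualBases.tensorR`,
`hasDualBases_bottSamelson`).

*Saturation.* Let `M` and `N` have such dual bases for one side, say the left. A bimodule
homomorphism `φ : M → N` is determined by its matrix entries `c_j (φ (e_i))`, which are elements of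
the graded dual of `Hom^•(M, N)`. They embed `Hom^•(M, N)` into a free module `R^n`. The image is
saturated: if `r v` is the matrix of `φ` and `r ≠ 0`, then `φ` takes values in `r N`, and as `N` is
torsion-free, `φ = r ψ` for a bimodule homomorphism `ψ` with matrix `v`. As `M` is finitely
generated, `ψ` is a sum of homogeneous maps (`isReflexive_hom_of_dualBasis`).

*Reflexivity.* Let `K ⊆ R^n` be saturated, with coordinates `f_i` in `K^∨`, and let `θ ∈ K^∨∨`.
For any finite family of forms `g_j ∈ K^∨`, the vector `(θ (g_j))_j` satisfies all linear relations
between the `g_j`, hence lies in the span of the vectors `(g_j (y))_j`, `y ∈ K`, over the field of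
fractions (`exists_smul_eq_of_relations`). For the family `f_i`, saturation yields `z ∈ K` with
`θ (f_i) = f_i (z)`; for the `f_i` together with one more form `g`, it follows that
`θ (g) = g (z)`. So `θ` is evaluation at `z` (`GrMod.isReflexive_of_saturated`).
-/

noncomputable section

universe u

open DirectSum TensorProduct

namespace Soergel

/-! ### Reflexivity of saturated submodules -/

/-- If a vector `x` over a domain satisfies all linear relations satisfied by the tuples
`(F j y)_j`, then a nonzero multiple of `x` is such a tuple. -/
theorem exists_smul_eq_of_relations {R K J : Type*} [CommRing R] [IsDomain R] [AddCommGroup K]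
    [Module R K] [Fintype J] (F : J → K →ₗ[R] R) (x : J → R)
    (h : ∀ a : J → R, (∀ y, ∑ j, a j * F j y = 0) → ∑ j, a j * x j = 0) :
    ∃ r : R, r ≠ 0 ∧ ∃ y, ∀ j, r * x j = F j y := by
  classical
  let Q := FractionRing R
  let e : R → Q := algebraMap R Q
  have he : Function.Injective e := IsFractionRing.injective R Q
  let U : Submodule Q (J → Q) := Submodule.span Q (Set.range fun y j => e (F j y))
  have hU : ∀ u ∈ U, ∃ r : R, r ≠ 0 ∧ ∃ y, ∀ j, e r * u j = e (F j y) := by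
    intro u hu
    induction hu using Submodule.span_induction with
    | mem u hu =>
      obtain ⟨y, rfl⟩ := hu
      exact ⟨1, one_ne_zero, y, fun j => by simp [e]⟩
    | zero => exact ⟨1, one_ne_zero, 0, fun j => by simp [e]⟩
    | add u v _ _ hu hv =>
      obtain ⟨r, hr, y, hy⟩ := hu
      obtain ⟨s, hs, z, hz⟩ := hv
      refine ⟨r * s, mul_ne_zero hr hs, s • y + r • z, fun j => ?_⟩
      simp only [e, map_add, map_smul, smul_eq_mul, map_mul, Pi.add_apply] at hy hz ⊢
      rw [← hy j, ← hz j]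
      ring
    | smul q u _ hu =>
      obtain ⟨r, hr, y, hy⟩ := hu
      obtain ⟨a, s, hs, rfl⟩ := IsFractionRing.div_surjective (A := R) q
      have hs0 : s ≠ 0 := nonZeroDivisors.ne_zero hs
      have hs1 : algebraMap R Q s ≠ 0 := fun h0 => hs0 (he (h0.trans (map_zero _).symm))
      refine ⟨r * s, mul_ne_zero hr hs0, a • y, fun j => ?_⟩
      simp only [e, map_smul, smul_eq_mul, map_mul, Pi.smul_apply] at hy ⊢
      rw [← hy j]
      linear_combination (algebraMap R Q r * u j) * div_mul_cancel₀ (algebraMap R Q a) hs1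
  by_cases hx : (fun j => e (x j)) ∈ U
  · obtain ⟨r, hr, y, hy⟩ := hU _ hx
    refine ⟨r, hr, y, fun j => he ?_⟩
    rw [← hy j]
    exact map_mul (algebraMap R Q) _ _
  · exfalso
    obtain ⟨φ, hφ, hφU⟩ := Submodule.exists_le_ker_of_notMem hx
    obtain ⟨b, hb⟩ := IsLocalization.exist_integer_multiples_of_finite (nonZeroDivisors R)
      (fun j : J => φ fun i => if j = i then (1 : Q) else 0)
    choose a ha using hb
    have key : ∀ v : J → R, e (∑ j, a j * v j) = e b * φ fun j => e (v j) := by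
      intro v
      rw [LinearMap.pi_apply_eq_sum_univ φ, Finset.mul_sum]
      simp only [e, map_sum, map_mul, smul_eq_mul]
      refine Finset.sum_congr rfl fun j _ => ?_
      rw [ha j, Algebra.smul_def]
      ring
    have h0 := h a fun y => he (by
      rw [key fun j => F j y, show φ (fun j => e (F j y)) = 0 from
        hφU (Submodule.subset_span ⟨y, rfl⟩), mul_zero]
      exact (map_zero _).symm)
    have h1 := key x
    rw [h0] at h1
    have h2 : e 0 = 0 := map_zero (algebraMap R Q)
    rw [h2] at h1
    refine (mul_ne_zero ?_ hφ) h1.symm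
    exact fun h3 => nonZeroDivisors.ne_zero b.2 (he (h3.trans h2.symm))

section Criterion

variable {R : Type u} [CommRing R] [IsDomain R] {𝒜 : ℤ → AddSubgroup R} [GradedRing 𝒜]

/-- A graded module over a domain is reflexive if finitely many elements of its graded dual embed
it in a free module with saturated image: `r v` lies in the image for some `r ≠ 0` only if `v`
does. -/
theorem GrMod.isReflexive_of_saturated {I : Type*} [Fintype I] (K : GrMod 𝒜)
    (f : I → homBullet K (GrMod.ring 𝒜))
    (hinj : ∀ y, (∀ i, (f i).1 y = (0 : R)) → y = 0)
    (hsat : ∀ r : R, r ≠ 0 → ∀ y, ∀ v : I → R, (∀ i, r * v i = (f i).1 y) →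
      ∃ z, ∀ i, (f i).1 z = v i) : K.IsReflexive := by
  classical
  constructor
  · rw [injective_iff_map_eq_zero]
    intro y hy
    refine hinj y fun i => ?_
    exact DFunLike.congr_fun (congrArg Subtype.val hy) (f i)
  · intro θ
    let T : homBullet K (GrMod.ring 𝒜) →ₗ[R] R := θ.1
    have approx : ∀ (J : Type _) [Fintype J] (F : J → homBullet K (GrMod.ring 𝒜)),
        ∃ r : R, r ≠ 0 ∧ ∃ y, ∀ j, r * T (F j) = ((F j).1 : K.carrier →ₗ[R] R) y := by
      intro J _ F
      refine exists_smul_eq_of_relations (fun j => ((F j).1 : K.carrier →ₗ[R] R)) _ fun a ha => ?_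
      have h0 : ∑ j, a j • F j = 0 := by
        refine Subtype.ext (LinearMap.ext fun y => ?_)
        have h := ha y
        rw [AddSubmonoidClass.coe_finsetSum]
        refine Eq.trans ?_ h
        exact LinearMap.sum_apply _ _ _
      have h1 := congrArg T h0
      rw [map_sum, map_zero] at h1
      rw [← h1]
      exact Finset.sum_congr rfl fun j _ => (map_smul T (a j) (F j)).symm
    obtain ⟨r, hr, y, hy⟩ := approx I f
    obtain ⟨z, hz⟩ := hsat r hr y (fun i => T (f i)) hy
    refine ⟨z, Subtype.ext (LinearMap.ext fun g => ?_)⟩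
    -- Adjoining `g` to the coordinates gives a multiple of `(T f, T g)` realised by some `y'`;
    -- the coordinates force `y' = s z`.
    obtain ⟨s, hs, y', hy'⟩ := approx (Option I) fun o => o.elim g f
    have hy'' : y' = s • z := by
      refine sub_eq_zero.1 (hinj _ fun i => ?_)
      have h := hy' (some i)
      change s * T (f i) = (f i).1 y' at h
      have h2 : (f i).1 (s • z) = s * T (f i) :=
        (map_smul (f i).1 s z).trans (congrArg (s * ·) (hz i))
      rw [map_sub, h2, ← h]
      exact sub_self _
    have h := hy' none
    change s * T g = (g.1 : K.carrier →ₗ[R] R) y' at h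
    let G : K.carrier →ₗ[R] R := g.1
    have h2 : G (s • z) = s * G z := map_smul G s z
    rw [hy''] at h
    replace h := h.trans h2
    exact (mul_left_cancel₀ hs h).symm

end Criterion

/-! ### Homogeneous dual bases -/

section DualBasis

variable {R : Type u} [CommRing R]

theorem act_add_apply {X : Type*} [AddCommGroup X] (act : R →+* AddMonoid.End X) (r s : R)
    (x : X) : act (r + s) x = act r x + act s x := by
  rw [map_add]; rfl

/-- A finite homogeneous dual basis, over a subring `A` of `R`, of a graded abelian group on which
`R` acts: elements `e i` of degree `d i` and homogeneous `A`-valued `A`-linear forms `c i` with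
`m = ∑ i, (c i m) (e i)`. The `e i` need not be linearly independent, so that this expresses that
the module is finitely generated graded projective. -/
structure DualBasis (𝒜 : ℤ → AddSubgroup R) {X : Type u} [AddCommGroup X]
    (act : R →+* AddMonoid.End X) (deg : ℤ → AddSubgroup X) (A : Subring R)
    (I : Type) [Fintype I] where
  e : I → X
  d : I → ℤ
  c : I → X →+ R
  e_mem : ∀ i, e i ∈ deg (d i)
  c_mem : ∀ i j, ∀ m ∈ deg j, c i m ∈ 𝒜 (j - d i)
  c_mem_subring : ∀ i m, c i m ∈ A
  c_act : ∀ i, ∀ a ∈ A, ∀ m, c i (act a m) = a * c i m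
  sum_eq : ∀ m, ∑ i, act (c i m) (e i) = m

end DualBasis

section Internal

variable {M : Type u} [AddCommGroup M] {deg : ℤ → AddSubgroup M}

/-- An element is the sum of its homogeneous components, over any large enough finite set of
degrees. -/
theorem exists_sum_homogProj (h : DirectSum.IsInternal deg) (m : M) :
    ∃ S : Finset ℤ, ∀ S', S ⊆ S' → ∑ n ∈ S', homogProj h n m = m := by
  classical
  refine homog_induction deg (iSup_eq_top_of_isInternal h)
    (C := fun m => ∃ S : Finset ℤ, ∀ S', S ⊆ S' → ∑ n ∈ S', homogProj h n m = m) ?_ ?_ ?_ m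
  · intro n m hm
    refine ⟨{n}, fun S' hS' => ?_⟩
    rw [Finset.sum_eq_single n (fun k _ hk => homogProj_ne h hm (Ne.symm hk))
      (fun hn => absurd (hS' (Finset.mem_singleton_self n)) hn), homogProj_same h hm]
  · exact ⟨∅, fun S' _ => by simp⟩
  · rintro x y ⟨S, hS⟩ ⟨T, hT⟩
    refine ⟨S ∪ T, fun S' hS' => ?_⟩
    simp only [map_add, Finset.sum_add_distrib]
    rw [hS S' (Finset.union_subset_left hS'), hT S' (Finset.union_subset_right hS')]

theorem homogProj_mem (h : DirectSum.IsInternal deg) (n : ℤ) (m : M) :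
    homogProj h n m ∈ deg n := by
  refine homog_induction deg (iSup_eq_top_of_isInternal h)
    (C := fun m => homogProj h n m ∈ deg n) ?_ (by rw [map_zero]; exact zero_mem _)
    (fun x y hx hy => by rw [map_add]; exact add_mem hx hy) m
  intro k m hm
  by_cases hkn : k = n
  · subst hkn; rwa [homogProj_same h hm]
  · rw [homogProj_ne h hm hkn]; exact zero_mem _

/-- Homogeneous components commute with an additive map that raises degrees by `i`. -/
theorem homogProj_map {N : Type u} [AddCommGroup N] {deg' : ℤ → AddSubgroup N}
    (h : DirectSum.IsInternal deg) (h' : DirectSum.IsInternal deg') (f : M →+ N) {i : ℤ}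
    (hf : ∀ k, ∀ m ∈ deg k, f m ∈ deg' (i + k)) (k : ℤ) (m : M) :
    homogProj h' (i + k) (f m) = f (homogProj h k m) := by
  refine homog_induction deg (iSup_eq_top_of_isInternal h)
    (C := fun m => homogProj h' (i + k) (f m) = f (homogProj h k m)) ?_ (by simp only [map_zero])
    (fun a b ha hb => by simp only [map_add, ha, hb]) m
  intro j m hm
  by_cases hjk : j = k
  · subst hjk
    rw [homogProj_same _ hm, homogProj_same _ (hf _ _ hm)]
  · rw [homogProj_ne _ hm hjk, homogProj_ne _ (hf _ _ hm) (by omega), map_zero]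

end Internal

/-! ### Reflexivity of bimodule homomorphisms -/

section Hom

variable {R : Type u} [CommRing R] {𝒜 : ℤ → AddSubgroup R}

namespace GrBimod

variable {M N : GrBimod 𝒜}

theorem map_left_of_mem_homBullet {φ : M.carrier →+ N.carrier} (hφ : φ ∈ homBullet M N) (r : R)
    (m : M.carrier) : φ (M.left r m) = N.left r (φ m) :=
  AddSubgroup.iSup_induction _ (C := fun φ => φ (M.left r m) = N.left r (φ m)) hφ
    (fun _ _ h => h.1 r m) (map_zero (N.left r)).symm
    (fun a b ha hb => by rw [AddMonoidHom.add_apply, AddMonoidHom.add_apply, ha, hb, map_add])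

theorem map_right_of_mem_homBullet {φ : M.carrier →+ N.carrier} (hφ : φ ∈ homBullet M N) (r : R)
    (m : M.carrier) : φ (M.right r m) = N.right r (φ m) :=
  AddSubgroup.iSup_induction _ (C := fun φ => φ (M.right r m) = N.right r (φ m)) hφ
    (fun _ _ h => h.2.1 r m) (map_zero (N.right r)).symm
    (fun a b ha hb => by rw [AddMonoidHom.add_apply, AddMonoidHom.add_apply, ha, hb, map_add])

variable [GradedRing 𝒜]

/-- The homogeneous components of a map are linear for any action by which it is linear. -/
theorem component_linear {X Y : Type u} [AddCommGroup X] [AddCommGroup Y]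
    {degX : ℤ → AddSubgroup X} {degY : ℤ → AddSubgroup Y}
    (hX : DirectSum.IsInternal degX) (hY : DirectSum.IsInternal degY)
    {aX : R →+* AddMonoid.End X} {aY : R →+* AddMonoid.End Y}
    (haX : ∀ {i j : ℤ} {r : R} {m : X}, r ∈ 𝒜 i → m ∈ degX j → aX r m ∈ degX (i + j))
    (haY : ∀ {i j : ℤ} {r : R} {m : Y}, r ∈ 𝒜 i → m ∈ degY j → aY r m ∈ degY (i + j))
    {φ ψ : X →+ Y} {n : ℤ} (hφ : ∀ r m, φ (aX r m) = aY r (φ m))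
    (hψ : ∀ j, ∀ m ∈ degX j, ψ m = homogProj hY (n + j) (φ m)) (r : R) (m : X) :
    ψ (aX r m) = aY r (ψ m) := by
  refine homog_induction 𝒜 (iSup_eq_top_of_isInternal (isInternal_ring 𝒜))
    (C := fun r => ψ (aX r m) = aY r (ψ m)) ?_
    (by simp only [map_zero, AddMonoid.End.zero_apply])
    (fun a b ha hb => by rw [act_add_apply, act_add_apply, map_add, ha, hb]) r
  intro i r hr
  refine homog_induction degX (iSup_eq_top_of_isInternal hX)
    (C := fun m => ψ (aX r m) = aY r (ψ m)) ?_ (by simp only [map_zero])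
    (fun a b ha hb => by simp only [map_add, ha, hb]) m
  intro j m hm
  have h := homogProj_map hY hY (aY r) (fun k y hy => haY hr hy) (n + j) (φ m)
  rw [show i + (n + j) = n + (i + j) by ring] at h
  rw [hψ _ _ (haX hr hm), hψ _ _ hm, hφ]
  exact h

/-- Every bimodule homomorphism out of a bimodule that is finitely generated on one side is a
finite sum of homogeneous ones. -/
theorem mem_homBullet_of_dualBasis {aM : R →+* AddMonoid.End M.carrier}
    {aN : R →+* AddMonoid.End N.carrier} {I : Type} [Fintype I]
    (bM : DualBasis 𝒜 aM M.deg ⊤ I)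
    (haN : ∀ {i j : ℤ} {r : R} {m : N.carrier}, r ∈ 𝒜 i → m ∈ N.deg j → aN r m ∈ N.deg (i + j))
    {φ : M.carrier →+ N.carrier} (hl : ∀ r m, φ (M.left r m) = N.left r (φ m))
    (hr : ∀ r m, φ (M.right r m) = N.right r (φ m))
    (ha : ∀ r m, φ (aM r m) = aN r (φ m)) : φ ∈ homBullet M N := by
  classical
  let ψ : ℤ → M.carrier →+ N.carrier := fun n => ∑ i,
    (aN.toAddMonoidHom.flip (homogProj N.isInternal (n + bM.d i) (φ (bM.e i)))).comp (bM.c i)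
  have hψ_apply : ∀ n m, ψ n m =
      ∑ i, aN (bM.c i m) (homogProj N.isInternal (n + bM.d i) (φ (bM.e i))) := by
    intro n m
    exact AddMonoidHom.finsetSum_apply _ _ _
  have hφ_apply : ∀ m, φ m = ∑ i, aN (bM.c i m) (φ (bM.e i)) := by
    intro m
    conv_lhs => rw [← bM.sum_eq m]
    rw [map_sum]
    exact Finset.sum_congr rfl fun i _ => ha _ _
  have hψ : ∀ n j, ∀ m ∈ M.deg j, ψ n m = homogProj N.isInternal (n + j) (φ m) := by
    intro n j m hm
    rw [hψ_apply, hφ_apply m, map_sum]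
    refine Finset.sum_congr rfl fun i _ => ?_
    have h := homogProj_map N.isInternal N.isInternal (aN (bM.c i m))
      (fun k y hy => haN (bM.c_mem i j m hm) hy) (n + bM.d i) (φ (bM.e i))
    rw [show j - bM.d i + (n + bM.d i) = n + j by ring] at h
    exact h.symm
  have hmem : ∀ n, ψ n ∈ homDeg M N n := fun n =>
    ⟨component_linear M.isInternal N.isInternal M.left_mem N.left_mem hl (hψ n),
      component_linear M.isInternal N.isInternal M.right_mem N.right_mem hr (hψ n),
      fun j m hm => by rw [hψ n j m hm]; exact homogProj_mem _ _ _⟩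
  choose S hS using fun i => exists_sum_homogProj N.isInternal (φ (bM.e i))
  let T : Finset ℤ := Finset.univ.biUnion fun i => (S i).image fun n => n - bM.d i
  have hsum : φ = ∑ n ∈ T, ψ n := by
    refine AddMonoidHom.ext fun m => ?_
    rw [AddMonoidHom.finsetSum_apply, hφ_apply m]
    simp only [hψ_apply]
    rw [Finset.sum_comm]
    refine Finset.sum_congr rfl fun i _ => ?_
    rw [← map_sum]
    congr 1
    have h := hS i (T.image fun n => n + bM.d i) fun n hn => Finset.mem_image.2
      ⟨n - bM.d i, Finset.mem_biUnion.2 ⟨i, Finset.mem_univ _, Finset.mem_image_of_mem _ hn⟩,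
        by ring⟩
    rw [Finset.sum_image fun a _ b _ hab => add_right_cancel hab] at h
    exact h.symm
  rw [hsum]
  exact sum_mem fun n _ => AddSubgroup.mem_iSup_of_mem (S := homDeg M N) n (hmem n)

/-- Let `aM`, `aN` be the left actions, or the right actions, on `M` and `N`, and let `K` be
`Hom^•(M, N)` as a module for this side. If `M` and `N` have finite homogeneous dual bases for
this side over a domain, then `K` is reflexive: the matrix entries of bimodule homomorphisms embed
`K` as a saturated submodule of a free module, because `N` is torsion-free. -/
theorem isReflexive_hom_of_dualBasis [IsDomain R] (K : GrMod 𝒜)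
    (aM : R →+* AddMonoid.End M.carrier) (aN : R →+* AddMonoid.End N.carrier)
    {I J : Type} [Fintype I] [Fintype J]
    (bM : DualBasis 𝒜 aM M.deg ⊤ I) (bN : DualBasis 𝒜 aN N.deg ⊤ J)
    (haN : ∀ {i j : ℤ} {r : R} {m : N.carrier}, r ∈ 𝒜 i → m ∈ N.deg j → aN r m ∈ N.deg (i + j))
    (hlin : ∀ φ : M.carrier →+ N.carrier, (∀ r m, φ (M.left r m) = N.left r (φ m)) →
      (∀ r m, φ (M.right r m) = N.right r (φ m)) → ∀ r m, φ (aM r m) = aN r (φ m))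
    (hcl : ∀ r s m, N.left r (aN s m) = aN s (N.left r m))
    (hcr : ∀ r s m, N.right r (aN s m) = aN s (N.right r m))
    (κ : K.carrier ≃+ homBullet M N) (hκ : ∀ r x m, (κ (r • x)).1 m = aN r ((κ x).1 m))
    (hκd : ∀ n, ∀ x ∈ K.deg n, (κ x).1 ∈ homDeg M N n) : K.IsReflexive := by
  classical
  have hzero : ∀ n, (∀ j, bN.c j n = 0) → n = 0 := by
    intro n hn
    rw [← bN.sum_eq n]
    refine Finset.sum_eq_zero fun j _ => ?_
    rw [hn j, map_zero]
    rfl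
  have hcancel : ∀ r : R, r ≠ 0 → ∀ n n', aN r n = aN r n' → n = n' := by
    intro r hr n n' h
    refine sub_eq_zero.1 (hzero _ fun j => ?_)
    refine (mul_eq_zero.1 ?_).resolve_left hr
    rw [← bN.c_act j r trivial, map_sub, h, sub_self, map_zero]
  have hκlin : ∀ x r m, (κ x).1 (aM r m) = aN r ((κ x).1 m) := fun x => hlin _
    (map_left_of_mem_homBullet (κ x).2) (map_right_of_mem_homBullet (κ x).2)
  let f : I × J → K.carrier →ₗ[R] R := fun p =>
    { toFun := fun x => bN.c p.2 ((κ x).1 (bM.e p.1))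
      map_add' := fun x y => by
        rw [map_add, AddSubgroup.coe_add, AddMonoidHom.add_apply, map_add]
      map_smul' := fun r x => by
        rw [hκ, bN.c_act _ _ trivial]
        rfl }
  refine GrMod.isReflexive_of_saturated (I := I × J) K (fun p => ⟨f p,
    GrMod.homDeg_le K (GrMod.ring 𝒜) (bM.d p.1 - bN.d p.2) fun n x hx => ?_⟩) ?_ ?_
  · have h := bN.c_mem p.2 _ _ ((hκd n x hx).2.2 _ _ (bM.e_mem p.1))
    rwa [show n + bM.d p.1 - bN.d p.2 = bM.d p.1 - bN.d p.2 + n by ring] at h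
  · intro x hx
    rw [← κ.map_eq_zero_iff]
    refine Subtype.ext (AddMonoidHom.ext fun m => ?_)
    rw [← bM.sum_eq m, map_sum]
    refine Finset.sum_eq_zero fun i _ => ?_
    rw [hκlin, hzero ((κ x).1 (bM.e i)) fun j => hx (i, j), map_zero]
  · intro r hr x v hv
    have hdiv : ∀ i, (κ x).1 (bM.e i) = aN r (∑ j, aN (v (i, j)) (bN.e j)) := by
      intro i
      rw [← bN.sum_eq ((κ x).1 (bM.e i)), map_sum]
      refine Finset.sum_congr rfl fun j _ => ?_
      have h : r * v (i, j) = bN.c j ((κ x).1 (bM.e i)) := hv (i, j)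
      rw [← h, map_mul]
      rfl
    let ψ : M.carrier →+ N.carrier := ∑ i,
      (aN.toAddMonoidHom.flip (∑ j, aN (v (i, j)) (bN.e j))).comp (bM.c i)
    have hψ : ∀ m, aN r (ψ m) = (κ x).1 m := by
      intro m
      have h1 : ψ m = ∑ i, aN (bM.c i m) (∑ j, aN (v (i, j)) (bN.e j)) :=
        AddMonoidHom.finsetSum_apply _ _ _
      rw [h1]
      conv_rhs => rw [← bM.sum_eq m]
      rw [map_sum, map_sum]
      refine Finset.sum_congr rfl fun i _ => ?_
      rw [hκlin, hdiv, act_comm]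
    have hl : ∀ s m, ψ (M.left s m) = N.left s (ψ m) := fun s m => hcancel r hr _ _ (by
      rw [hψ, ← hcl, hψ, map_left_of_mem_homBullet (κ x).2])
    have hr' : ∀ s m, ψ (M.right s m) = N.right s (ψ m) := fun s m => hcancel r hr _ _ (by
      rw [hψ, ← hcr, hψ, map_right_of_mem_homBullet (κ x).2])
    have hmem := mem_homBullet_of_dualBasis bM haN hl hr' (hlin ψ hl hr')
    refine ⟨κ.symm ⟨ψ, hmem⟩, fun p => ?_⟩
    change bN.c p.2 ((κ (κ.symm ⟨ψ, hmem⟩)).1 (bM.e p.1)) = v p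
    rw [AddEquiv.apply_symm_apply]
    refine mul_left_cancel₀ hr ?_
    rw [← bN.c_act _ _ trivial, hψ]
    exact (hv p).symm

theorem isReflexive_hom_toLeft [IsDomain R] {I J : Type} [Fintype I] [Fintype J]
    (bM : DualBasis 𝒜 M.left M.deg ⊤ I) (bN : DualBasis 𝒜 N.left N.deg ⊤ J) :
    (hom M N).toLeft.IsReflexive :=
  isReflexive_hom_of_dualBasis _ M.left N.left bM bN N.left_mem (fun _ hl _ => hl)
    (act_comm N.left) (fun r s m => (N.comm s r m).symm) (AddEquiv.refl (homBullet M N))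
    (fun _ _ _ => rfl) fun _ _ hx => hx

theorem isReflexive_hom_toRight [IsDomain R] {I J : Type} [Fintype I] [Fintype J]
    (bM : DualBasis 𝒜 M.right M.deg ⊤ I) (bN : DualBasis 𝒜 N.right N.deg ⊤ J) :
    (hom M N).toRight.IsReflexive :=
  isReflexive_hom_of_dualBasis _ M.right N.right bM bN N.right_mem (fun _ _ hr => hr)
    N.comm (act_comm N.right) (AddEquiv.refl (homBullet M N))
    (fun _ _ _ => rfl) fun _ _ hx => hx

end GrBimod

end Hom

/-! ### Dual bases of tensor products and of extensions of invariants -/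

section Constructions

variable {R : Type u} [CommRing R] {𝒜 : ℤ → AddSubgroup R}

theorem act_mul_apply {X : Type*} [AddCommGroup X] (act : R →+* AddMonoid.End X) (r s : R)
    (x : X) : act (r * s) x = act r (act s x) := by
  rw [map_mul]; rfl

theorem act_sum_apply {X I : Type*} [AddCommGroup X] (act : R →+* AddMonoid.End X)
    (s : Finset I) (r : I → R) (x : X) : act (∑ i ∈ s, r i) x = ∑ i ∈ s, act (r i) x :=
  map_sum (act.toAddMonoidHom.flip x) r s

/-- Restriction of scalars of a dual basis along a finite graded projective extension `A ⊆ R`. -/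
def DualBasis.restrict {X : Type u} [AddCommGroup X] {act : R →+* AddMonoid.End X}
    {deg : ℤ → AddSubgroup X} {A : Subring R} {I K : Type} [Fintype I] [Fintype K]
    (hact : ∀ {i j : ℤ} {r : R} {m : X}, r ∈ 𝒜 i → m ∈ deg j → act r m ∈ deg (i + j))
    (b : DualBasis 𝒜 act deg ⊤ I) (bR : DualBasis 𝒜 (Module.toAddMonoidEnd R R) 𝒜 A K) :
    DualBasis 𝒜 act deg A (I × K) where
  e p := act (bR.e p.2) (b.e p.1)
  d p := bR.d p.2 + b.d p.1
  c p := (bR.c p.2).comp (b.c p.1)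
  e_mem p := hact (bR.e_mem p.2) (b.e_mem p.1)
  c_mem p j m hm := by
    have h := bR.c_mem p.2 _ _ (b.c_mem p.1 j m hm)
    rwa [show j - b.d p.1 - bR.d p.2 = j - (bR.d p.2 + b.d p.1) by ring] at h
  c_mem_subring p m := bR.c_mem_subring p.2 _
  c_act p a ha m := by
    change bR.c p.2 (b.c p.1 (act a m)) = a * bR.c p.2 (b.c p.1 m)
    rw [b.c_act p.1 a trivial]
    exact bR.c_act p.2 a ha _
  sum_eq m := by
    conv_rhs => rw [← b.sum_eq m]
    rw [Fintype.sum_prod_type]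
    refine Finset.sum_congr rfl fun i _ => ?_
    conv_rhs => rw [← bR.sum_eq (b.c i m)]
    rw [act_sum_apply]
    exact Finset.sum_congr rfl fun k _ => (act_mul_apply act _ _ _).symm

/-- If `f` is an involution, `f α = -α` and `2 α` is nonzero and divides all differences
`r - f r`, then `R` is spanned by `1` and `α` over the invariants of `f`: the coordinate of `r` at
`α` is `(r - f r) / (2 α)`. -/
theorem nonempty_dualBasis_eqLocus [GradedRing 𝒜] [IsDomain R] (f : R →+* R)
    (hf : ∀ n, ∀ r ∈ 𝒜 n, f r ∈ 𝒜 n) (hff : ∀ r, f (f r) = r) {α : R} {d : ℤ} (hα : α ∈ 𝒜 d)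
    (h0 : 2 * α ≠ 0) (hfα : f α = -α) (hdvd : ∀ r, 2 * α ∣ r - f r) :
    Nonempty (DualBasis 𝒜 (Module.toAddMonoidEnd R R) 𝒜 (f.eqLocus (RingHom.id R)) Bool) := by
  choose q hq using hdvd
  let c₁ : R →+ R := AddMonoidHom.mk' q fun r s => mul_left_cancel₀ h0 (by
    rw [mul_add, ← hq, ← hq, ← hq, map_add]; ring)
  have hc₁ : ∀ r, r - f r = 2 * α * c₁ r := hq
  let c₀ : R →+ R := AddMonoidHom.id R - (AddMonoidHom.mulLeft α).comp c₁
  have hc₀ : ∀ r, c₀ r = r - α * c₁ r := fun r => rfl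
  have hinv₁ : ∀ r, f (c₁ r) = c₁ r := fun r => mul_left_cancel₀ h0 (by
    have h1 := congrArg f (hc₁ r)
    rw [map_sub, hff, map_mul, map_mul, hfα, map_ofNat] at h1
    linear_combination h1 + hc₁ r)
  have hinv₀ : ∀ r, f (c₀ r) = c₀ r := fun r => by
    rw [hc₀, map_sub, map_mul, hfα, hinv₁]
    linear_combination -hc₁ r
  have hlin₁ : ∀ a, f a = a → ∀ r, c₁ (a * r) = a * c₁ r := fun a ha r =>
    mul_left_cancel₀ h0 (by
      have h1 := hc₁ (a * r)
      rw [map_mul, ha] at h1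
      linear_combination a * hc₁ r - h1)
  have hlin₀ : ∀ a, f a = a → ∀ r, c₀ (a * r) = a * c₀ r := fun a ha r => by
    rw [hc₀, hc₀, hlin₁ a ha]
    ring
  have h2α : ∀ k, ∀ r ∈ 𝒜 k, 2 * α * r ∈ 𝒜 (d + k) := fun k r hr => by
    rw [two_mul]
    exact SetLike.mul_mem_graded (add_mem hα hα) hr
  -- `2 α` is a homogeneous nonzerodivisor, so a quotient of a homogeneous element by it is
  -- homogeneous.
  have hdeg₁ : ∀ j, ∀ r ∈ 𝒜 j, c₁ r ∈ 𝒜 (j - d) := fun j r hr => by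
    have h := homogProj_map (isInternal_ring 𝒜) (isInternal_ring 𝒜)
      (AddMonoidHom.mulLeft (2 * α)) h2α (j - d) (c₁ r)
    change homogProj _ (d + (j - d)) (2 * α * c₁ r) = 2 * α * _ at h
    rw [add_sub_cancel, homogProj_same] at h
    · rw [mul_left_cancel₀ h0 h]
      exact homogProj_mem _ _ _
    · rw [← hc₁]
      exact sub_mem hr (hf j r hr)
  have hdeg₀ : ∀ j, ∀ r ∈ 𝒜 j, c₀ r ∈ 𝒜 j := fun j r hr => by
    have h := SetLike.mul_mem_graded hα (hdeg₁ j r hr)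
    rw [add_sub_cancel] at h
    exact sub_mem hr h
  exact ⟨{
    e := fun b => cond b α 1
    d := fun b => cond b d 0
    c := fun b => cond b c₁ c₀
    e_mem := by
      rintro (_ | _)
      exacts [SetLike.one_mem_graded 𝒜, hα]
    c_mem := by
      rintro (_ | _) j r hr
      · change c₀ r ∈ 𝒜 (j - 0)
        rw [sub_zero]
        exact hdeg₀ j r hr
      · exact hdeg₁ j r hr
    c_mem_subring := by
      rintro (_ | _) r
      exacts [hinv₀ r, hinv₁ r]
    c_act := by
      rintro (_ | _) a ha r
      exacts [hlin₀ a ha r, hlin₁ a ha r]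
    sum_eq := fun r => by
      rw [Fintype.sum_bool]
      change c₁ r * α + c₀ r * 1 = r
      rw [hc₀]
      ring }⟩

namespace GrBimod

section Tensor

variable (M N : GrBimod 𝒜) (A : Subring R) {I J : Type} [Fintype I] [Fintype J]

/-- The form `m ⊗ n ↦ f (m · g n)` on `M ⊗_A N`, for an `A`-linear form `g`. -/
def tensorCoordLeft (f : M.carrier →+ R) (g : N.carrier →+ R)
    (hg : ∀ a ∈ A, ∀ n, g (N.left a n) = a * g n) : TensorCarrier M N A →+ R :=
  tensorLift M N A
    (AddMonoidHom.mk' (fun m => f.comp ((M.right.toAddMonoidHom.flip m).comp g)) fun m m' => by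
      ext n
      change f (M.right (g n) (m + m')) = f (M.right (g n) m) + f (M.right (g n) m')
      rw [map_add, map_add])
    fun a m n => by
      change f (M.right (g n) (M.right a m)) = f (M.right (g (N.left a n)) m)
      rw [hg a a.2, mul_comm, act_mul_apply]

theorem tensorCoordLeft_tm (f : M.carrier →+ R) (g : N.carrier →+ R)
    (hg : ∀ a ∈ A, ∀ n, g (N.left a n) = a * g n) (m : M.carrier) (n : N.carrier) :
    tensorCoordLeft M N A f g hg (tm M N A m n) = f (M.right (g n) m) := rfl

/-- The form `m ⊗ n ↦ g (f m · n)` on `M ⊗_A N`, for an `A`-linear form `f`. -/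
def tensorCoordRight (f : M.carrier →+ R) (g : N.carrier →+ R)
    (hf : ∀ a ∈ A, ∀ m, f (M.right a m) = a * f m) : TensorCarrier M N A →+ R :=
  tensorLift M N A
    (AddMonoidHom.mk' (fun m => g.comp (N.left (f m))) fun m m' => by
      ext n
      change g (N.left (f (m + m')) n) = g (N.left (f m) n) + g (N.left (f m') n)
      rw [map_add, act_add_apply, map_add])
    fun a m n => by
      change g (N.left (f (M.right a m)) n) = g (N.left (f m) (N.left a n))
      rw [hf a a.2, mul_comm, act_mul_apply]

theorem tensorCoordRight_tm (f : M.carrier →+ R) (g : N.carrier →+ R)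
    (hf : ∀ a ∈ A, ∀ m, f (M.right a m) = a * f m) (m : M.carrier) (n : N.carrier) :
    tensorCoordRight M N A f g hf (tm M N A m n) = g (N.left (f m) n) := rfl

/-- A form on `M ⊗_A N` is homogeneous of degree `-d` if it is so on tensors of homogeneous
elements. -/
theorem map_tensorDeg_mem {c : TensorCarrier M N A →+ R} {d : ℤ}
    (h : ∀ i j, ∀ m ∈ M.deg i, ∀ n ∈ N.deg j, c (tm M N A m n) ∈ 𝒜 (i + j - d)) (k : ℤ)
    {x : TensorCarrier M N A} (hx : x ∈ tensorDeg M N A k) : c x ∈ 𝒜 (k - d) := by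
  induction hx using AddSubgroup.closure_induction with
  | zero => rw [map_zero]; exact zero_mem _
  | add x y _ _ hx hy => rw [map_add]; exact add_mem hx hy
  | neg x _ hx => rw [map_neg]; exact neg_mem hx
  | mem x hx =>
    obtain ⟨i, j, m, n, rfl, hm, hn, rfl⟩ := hx
    exact h i j m hm n hn

variable [GradedRing 𝒜]

/-- A form on `M ⊗_A N` is linear if it is so on pure tensors. -/
theorem map_act_of_tm {c : TensorCarrier M N A →+ R} {φ : AddMonoid.End (TensorCarrier M N A)}
    {a : R} (h : ∀ m n, c (φ (tm M N A m n)) = a * c (tm M N A m n))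
    (x : TensorCarrier M N A) : c (φ x) = a * c x :=
  tensor_induction M N A (C := fun x => c (φ x) = a * c x)
    (by rw [map_zero, map_zero, mul_zero]) h
    (fun x y hx hy => by rw [map_add, map_add, map_add, mul_add, hx, hy]) x

/-- The expansion of elements of `M ⊗_A N` has to be checked on pure tensors only. -/
theorem sum_act_of_tm {act : R →+* AddMonoid.End (TensorCarrier M N A)} {L : Type} [Fintype L]
    {c : L → TensorCarrier M N A →+ R} {e : L → TensorCarrier M N A}
    (h : ∀ m n, ∑ l, act (c l (tm M N A m n)) (e l) = tm M N A m n)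
    (x : TensorCarrier M N A) : ∑ l, act (c l x) (e l) = x :=
  tensor_induction M N A (C := fun x => ∑ l, act (c l x) (e l) = x)
    (Finset.sum_eq_zero fun l _ => by rw [map_zero, map_zero]; rfl) h
    (fun x y hx hy => by
      conv_rhs => rw [← hx, ← hy]
      rw [← Finset.sum_add_distrib]
      exact Finset.sum_congr rfl fun l _ => by rw [map_add, act_add_apply]) x

/-- The left dual basis of `M ⊗_A N` formed by the tensors `e i ⊗ e j`, with coordinates
`m ⊗ n ↦ c i (m · c j n)`. -/
def tensorDualBasisLeft (bM : DualBasis 𝒜 M.left M.deg ⊤ I) (bN : DualBasis 𝒜 N.left N.deg A J) :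
    DualBasis 𝒜 (tensorLeft M N A) (tensorDeg M N A) ⊤ (I × J) where
  e p := tm M N A (bM.e p.1) (bN.e p.2)
  d p := bM.d p.1 + bN.d p.2
  c p := tensorCoordLeft M N A (bM.c p.1) (bN.c p.2) (bN.c_act p.2)
  e_mem p := tm_mem_tensorDeg M N A (bM.e_mem p.1) (bN.e_mem p.2)
  c_mem p k x hx := map_tensorDeg_mem M N A (fun i j m hm n hn => by
    have h := bM.c_mem p.1 _ _ (M.right_mem (bN.c_mem p.2 j n hn) hm)
    rwa [show j - bN.d p.2 + i - bM.d p.1 = i + j - (bM.d p.1 + bN.d p.2) by ring] at h) k hx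
  c_mem_subring _ _ := trivial
  c_act p a _ := map_act_of_tm M N A fun m n => by
    change bM.c p.1 (M.right (bN.c p.2 n) (M.left a m)) = a * bM.c p.1 (M.right (bN.c p.2 n) m)
    rw [← M.comm, bM.c_act p.1 a trivial]
  sum_eq := sum_act_of_tm M N A fun m n => by
    simp only [tensorCoordLeft_tm]
    rw [Fintype.sum_prod_type, Finset.sum_comm]
    conv_rhs => rw [← bN.sum_eq n, map_sum]
    refine Finset.sum_congr rfl fun j _ => ?_
    have h := tm_balanced M N A ⟨_, bN.c_mem_subring j n⟩ m (bN.e j)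
    rw [← h]
    conv_rhs => rw [← bM.sum_eq (M.right (bN.c j n) m), map_sum, AddMonoidHom.finsetSum_apply]
    rfl

/-- The right dual basis of `M ⊗_A N` formed by the tensors `e i ⊗ e j`, with coordinates
`m ⊗ n ↦ c j (c i m · n)`. -/
def tensorDualBasisRight (bM : DualBasis 𝒜 M.right M.deg A I)
    (bN : DualBasis 𝒜 N.right N.deg ⊤ J) :
    DualBasis 𝒜 (tensorRight M N A) (tensorDeg M N A) ⊤ (I × J) where
  e p := tm M N A (bM.e p.1) (bN.e p.2)
  d p := bM.d p.1 + bN.d p.2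
  c p := tensorCoordRight M N A (bM.c p.1) (bN.c p.2) (bM.c_act p.1)
  e_mem p := tm_mem_tensorDeg M N A (bM.e_mem p.1) (bN.e_mem p.2)
  c_mem p k x hx := map_tensorDeg_mem M N A (fun i j m hm n hn => by
    have h := bN.c_mem p.2 _ _ (N.left_mem (bM.c_mem p.1 i m hm) hn)
    rwa [show i - bM.d p.1 + j - bN.d p.2 = i + j - (bM.d p.1 + bN.d p.2) by ring] at h) k hx
  c_mem_subring _ _ := trivial
  c_act p a _ := map_act_of_tm M N A fun m n => by
    change bN.c p.2 (N.left (bM.c p.1 m) (N.right a n)) = a * bN.c p.2 (N.left (bM.c p.1 m) n)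
    rw [N.comm, bN.c_act p.2 a trivial]
  sum_eq := sum_act_of_tm M N A fun m n => by
    simp only [tensorCoordRight_tm]
    rw [Fintype.sum_prod_type]
    conv_rhs => rw [← bM.sum_eq m, map_sum, AddMonoidHom.finsetSum_apply]
    refine Finset.sum_congr rfl fun i _ => ?_
    have h := tm_balanced M N A ⟨_, bM.c_mem_subring i m⟩ (bM.e i) n
    rw [h]
    conv_rhs => rw [← bN.sum_eq (N.left (bM.c i m) n), map_sum]
    rfl

end Tensor

variable [GradedRing 𝒜]

/-- The left dual basis `1` of a twisted bimodule. -/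
def twistDualBasisLeft (f : R →+* R) (hf : ∀ n, ∀ r ∈ 𝒜 n, f r ∈ 𝒜 n) :
    DualBasis 𝒜 (twist f hf).left (twist f hf).deg ⊤ Unit where
  e _ := (1 : R)
  d _ := 0
  c _ := AddMonoidHom.id R
  e_mem _ := SetLike.one_mem_graded 𝒜
  c_mem _ j m hm := by rw [sub_zero]; exact hm
  c_mem_subring _ _ := trivial
  c_act _ _ _ _ := rfl
  sum_eq m := by
    rw [Fintype.sum_unique]
    exact mul_one (M := R) m

/-- The right dual basis `1` of the bimodule twisted by an automorphism `f`; the coordinate is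
the inverse `g` of `f`. -/
def twistDualBasisRight (f g : R →+* R) (hf : ∀ n, ∀ r ∈ 𝒜 n, f r ∈ 𝒜 n)
    (hg : ∀ n, ∀ r ∈ 𝒜 n, g r ∈ 𝒜 n) (hfg : ∀ r, f (g r) = r) (hgf : ∀ r, g (f r) = r) :
    DualBasis 𝒜 (twist f hf).right (twist f hf).deg ⊤ Unit where
  e _ := (1 : R)
  d _ := 0
  c _ := g.toAddMonoidHom
  e_mem _ := SetLike.one_mem_graded 𝒜
  c_mem _ j m hm := by rw [sub_zero]; exact hg j m hm
  c_mem_subring _ _ := trivial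
  c_act _ a _ m :=
    (map_mul g (f a) m).trans (congrArg (fun r : R => r * g m) (hgf a))
  sum_eq m := by
    rw [Fintype.sum_unique]
    exact (mul_one (M := R) (f (g m))).trans (hfg m)

end GrBimod

end Constructions

/-! ### The action of reflections on `R` -/

section Reflection

universe v w b

variable {k : Type u} {V : Type v} {W : Type w} {B : Type b} [Field k] [AddCommGroup V]
  [Module k V] [Group W]

theorem symAct_ι (ρ : Representation k W V) (w : W) (v : V) :
    symAct ρ w (SymmetricAlgebra.ι k V v) = SymmetricAlgebra.ι k V (ρ w v) :=
  SymmetricAlgebra.lift_ι_apply _ _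

theorem symAct_one (ρ : Representation k W V) (a : SymmetricAlgebra k V) :
    symAct ρ 1 a = a := by
  have h : symAct ρ (1 : W) = AlgHom.id k _ := by
    refine SymmetricAlgebra.algHom_ext (LinearMap.ext fun v => ?_)
    change symAct ρ 1 (SymmetricAlgebra.ι k V v) = SymmetricAlgebra.ι k V v
    rw [symAct_ι, map_one, Module.End.one_apply]
  rw [h]; rfl

theorem symAct_mul (ρ : Representation k W V) (w w' : W) (a : SymmetricAlgebra k V) :
    symAct ρ (w * w') a = symAct ρ w (symAct ρ w' a) := by
  have h : symAct ρ (w * w') = (symAct ρ w).comp (symAct ρ w') := by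
    refine SymmetricAlgebra.algHom_ext (LinearMap.ext fun v => ?_)
    change symAct ρ (w * w') (SymmetricAlgebra.ι k V v) =
      symAct ρ w (symAct ρ w' (SymmetricAlgebra.ι k V v))
    rw [symAct_ι, symAct_ι, symAct_ι, map_mul, Module.End.mul_apply]
  rw [h]; rfl

/-- A conjugate of a reflection is a reflection. -/
theorem IsRoot.conj {ρ : Representation k W V} {s : W} {α : V} (h : IsRoot ρ s α) (w : W) :
    IsRoot ρ (w * s * w⁻¹) (ρ w α) := by
  obtain ⟨f, hf, hs⟩ := h
  have hw : ∀ v, ρ w⁻¹ (ρ w v) = v := fun v => by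
    rw [← Module.End.mul_apply, ← map_mul, inv_mul_cancel, map_one, Module.End.one_apply]
  have hw' : ∀ v, ρ w (ρ w⁻¹ v) = v := fun v => by
    rw [← Module.End.mul_apply, ← map_mul, mul_inv_cancel, map_one, Module.End.one_apply]
  refine ⟨f ∘ₗ ρ w⁻¹, ?_, fun v => ?_⟩
  · rw [LinearMap.comp_apply, hw, hf]
  · rw [map_mul, map_mul, Module.End.mul_apply, Module.End.mul_apply, hs, map_sub, map_smul, hw']
    rfl

/-- A reflection with root `α` moves every element of `Sym(V)` by a multiple of `α`. -/
theorem IsRoot.dvd_sub_symAct {ρ : Representation k W V} {t : W} {α : V} (h : IsRoot ρ t α)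
    (a : SymmetricAlgebra k V) : SymmetricAlgebra.ι k V α ∣ a - symAct ρ t a := by
  obtain ⟨f, -, ht⟩ := h
  induction a using SymmetricAlgebra.induction with
  | algebraMap r => rw [AlgHom.commutes, sub_self]; exact dvd_zero _
  | ι x =>
    rw [symAct_ι, ht, map_sub, sub_sub_cancel, map_smul, Algebra.smul_def]
    exact dvd_mul_left _ _
  | mul a c ha hc =>
    rw [map_mul, show a * c - symAct ρ t a * symAct ρ t c =
      (a - symAct ρ t a) * c + symAct ρ t a * (c - symAct ρ t c) by ring]
    exact dvd_add (ha.mul_right _) (hc.mul_left _)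
  | add a c ha hc =>
    rw [map_add, add_sub_add_comm]
    exact dvd_add ha hc

namespace ReflectionData

variable {M : CoxeterMatrix B} {cs : CoxeterSystem M W} (D : ReflectionData cs k V)

theorem exists_isRoot {t : W} (ht : cs.IsReflection t) : ∃ α, IsRoot D.ρ t α := by
  obtain ⟨w, i, rfl⟩ := ht
  obtain ⟨α, hα⟩ := D.exists_root i
  exact ⟨_, hα.conj w⟩

theorem σ_le_nonZeroDivisors : D.σ ≤ nonZeroDivisors (SymmetricAlgebra k V) := fun s hs =>
  mem_nonZeroDivisors_of_ne_zero (D.σ_ne_zero s hs)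

instance : IsDomain D.R :=
  IsLocalization.isDomain_of_le_nonZeroDivisors (M := D.σ) D.R D.σ_le_nonZeroDivisors

theorem act_algebraMap (w : W) (a : SymmetricAlgebra k V) :
    D.act w (algebraMap _ D.R a) = algebraMap _ D.R (symAct D.ρ w a) :=
  IsLocalization.map_eq _ _

theorem act_one (r : D.R) : D.act 1 r = r := by
  have h : D.act 1 = RingHom.id D.R := IsLocalization.ringHom_ext D.σ (RingHom.ext fun a => by
    change D.act 1 (algebraMap _ D.R a) = algebraMap _ D.R a
    rw [act_algebraMap, symAct_one])
  rw [h]; rfl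

theorem act_mul (w w' : W) (r : D.R) : D.act (w * w') r = D.act w (D.act w' r) := by
  have h : D.act (w * w') = (D.act w).comp (D.act w') :=
    IsLocalization.ringHom_ext D.σ (RingHom.ext fun a => by
      change D.act (w * w') (algebraMap _ D.R a) = D.act w (D.act w' (algebraMap _ D.R a))
      rw [act_algebraMap, act_algebraMap, act_algebraMap, symAct_mul])
  rw [h]; rfl

/-- A reflection with root `α` moves every element of `R` by a multiple of `α`. -/
theorem dvd_sub_act {t : W} {α : V} (h : IsRoot D.ρ t α) (r : D.R) :
    algebraMap _ D.R (SymmetricAlgebra.ι k V α) ∣ r - D.act t r := by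
  obtain ⟨a, s, rfl⟩ := IsLocalization.exists_mk'_eq D.σ r
  have hs : IsUnit (algebraMap _ D.R (s : SymmetricAlgebra k V)) := IsLocalization.map_units D.R s
  have hts := hs.map (D.act t)
  have hr := IsLocalization.mk'_spec D.R a s
  set r := IsLocalization.mk' D.R a s
  rw [← (hs.mul hts).dvd_mul_right]
  have key : (r - D.act t r) *
      (algebraMap _ D.R (s : SymmetricAlgebra k V) *
        D.act t (algebraMap _ D.R (s : SymmetricAlgebra k V))) =
      algebraMap _ D.R a * algebraMap _ D.R (symAct D.ρ t s - s) +
        algebraMap _ D.R (s : SymmetricAlgebra k V) * algebraMap _ D.R (a - symAct D.ρ t a) := by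
    rw [map_sub, map_sub, ← act_algebraMap, ← act_algebraMap, ← hr, map_mul]
    ring
  rw [key]
  refine dvd_add (Dvd.dvd.mul_left (map_dvd _ ?_) _) (Dvd.dvd.mul_left (map_dvd _ ?_) _)
  · rw [← neg_sub]
    exact (h.dvd_sub_symAct _).neg_right
  · exact h.dvd_sub_symAct a

theorem algebraMap_ι_mem_deg (α : V) :
    algebraMap _ D.R (SymmetricAlgebra.ι k V α) ∈ D.deg 2 := by
  refine AddSubgroup.subset_closure ⟨1, 0, SymmetricAlgebra.ι k V α, 1, ?_, one_mem_symDeg,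
    by norm_num, (IsLocalization.mk'_one (M := D.σ) D.R _).symm⟩
  rw [symDeg, pow_one]
  exact ⟨α, rfl⟩

/-- In characteristic different from `2`, the ring `R` is spanned over the invariants of a
reflection by `1` and the root. -/
theorem nonempty_dualBasis_invariants (hk : ringChar k ≠ 2) {t : W} (ht : cs.IsReflection t) :
    Nonempty (DualBasis D.deg (Module.toAddMonoidEnd D.R D.R) D.deg (D.invariants t) Bool) := by
  obtain ⟨α, hα⟩ := D.exists_isRoot ht
  have h2k : (2 : k) ≠ 0 := Ring.two_ne_zero hk
  have h2 : IsUnit (2 : D.R) := by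
    have h := ((isUnit_iff_ne_zero.2 h2k).map (algebraMap k (SymmetricAlgebra k V))).map
      (algebraMap (SymmetricAlgebra k V) D.R)
    rwa [map_ofNat, map_ofNat] at h
  refine nonempty_dualBasis_eqLocus (D.act t) (D.act_mem t) (fun r => ?_)
    (D.algebraMap_ι_mem_deg α) (mul_ne_zero h2.ne_zero ?_) ?_ fun r => ?_
  · rw [← act_mul, ht.mul_self, act_one]
  · obtain ⟨f, hf, -⟩ := hα
    rw [Ne, IsLocalization.to_map_eq_zero_iff D.R D.σ_le_nonZeroDivisors]
    -- The coroot extends to an algebra homomorphism `Sym(V) → k` with value `2` at the root.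
    intro h
    have h' := congrArg (SymmetricAlgebra.lift f) h
    rw [SymmetricAlgebra.lift_ι_apply, hf, map_zero] at h'
    exact h2k h'
  · obtain ⟨f, hf, ht⟩ := hα
    rw [act_algebraMap, symAct_ι, ht, hf, two_smul, sub_add_cancel_left, map_neg, map_neg]
  · rw [h2.mul_left_dvd]
    exact D.dvd_sub_act hα r

/-! ### Dual bases of twisted Bott–Samelson bimodules -/

/-- Existence of finite homogeneous dual bases of a bimodule for both sides. -/
def HasDualBases (N : GrBimod D.deg) : Prop :=
  (∃ (I : Type) (_ : Fintype I), Nonempty (DualBasis D.deg N.left N.deg ⊤ I)) ∧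
  ∃ (I : Type) (_ : Fintype I), Nonempty (DualBasis D.deg N.right N.deg ⊤ I)

variable {D} in
theorem HasDualBases.tensorR {M N : GrBimod D.deg} (hM : D.HasDualBases M)
    (hN : D.HasDualBases N) : D.HasDualBases (GrBimod.tensorR M N) := by
  obtain ⟨⟨I, _, ⟨b⟩⟩, I', _, ⟨b'⟩⟩ := hM
  obtain ⟨⟨J, _, ⟨c⟩⟩, J', _, ⟨c'⟩⟩ := hN
  exact ⟨⟨I × J, inferInstance, ⟨GrBimod.tensorDualBasisLeft M N ⊤ b c⟩⟩,
    I' × J', inferInstance, ⟨GrBimod.tensorDualBasisRight M N ⊤ b' c'⟩⟩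

theorem hasDualBases_twisted (w : W) : D.HasDualBases (D.twisted w) :=
  ⟨⟨Unit, inferInstance, ⟨GrBimod.twistDualBasisLeft _ _⟩⟩, Unit, inferInstance,
    ⟨GrBimod.twistDualBasisRight _ (D.act w⁻¹) _ (D.act_mem _)
      (fun r => by rw [← act_mul, mul_inv_cancel, act_one])
      fun r => by rw [← act_mul, inv_mul_cancel, act_one]⟩⟩

theorem hasDualBases_bottSamelson (hk : ringChar k ≠ 2) :
    ∀ t : List {t : W // cs.IsReflection t}, D.HasDualBases (D.bottSamelson t)
  | [] => ⟨⟨Unit, inferInstance, ⟨GrBimod.twistDualBasisLeft (RingHom.id D.R) fun _ _ hr => hr⟩⟩,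
      Unit, inferInstance,
      ⟨GrBimod.twistDualBasisRight (RingHom.id D.R) (RingHom.id D.R) (fun _ _ hr => hr)
        (fun _ _ hr => hr) (fun _ => rfl) fun _ => rfl⟩⟩
  | t :: ts => by
    obtain ⟨⟨J, _, ⟨c⟩⟩, J', _, ⟨c'⟩⟩ := hasDualBases_bottSamelson hk ts
    obtain ⟨b⟩ := D.nonempty_dualBasis_invariants hk t.2
    exact ⟨⟨Unit × (J × Bool), inferInstance,
      ⟨GrBimod.tensorDualBasisLeft D.unit (D.bottSamelson ts) (D.invariants t)
        (GrBimod.twistDualBasisLeft (RingHom.id D.R) fun _ _ hr => hr)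
        (c.restrict (D.bottSamelson ts).left_mem b)⟩⟩,
      Bool × J', inferInstance,
      ⟨GrBimod.tensorDualBasisRight D.unit (D.bottSamelson ts) (D.invariants t) b c'⟩⟩

end ReflectionData

end Reflection

end Soergel

end

theorem mainTheorem1 {k : Type*} {V : Type*} {W : Type*} {B : Type*} [Field k] [AddCommGroup V]
    [Module k V] [FiniteDimensional k V] (hk : ringChar k ≠ 2) [Group W] {M : CoxeterMatrix B}
    (cs : CoxeterSystem M W) (D : Soergel.ReflectionData cs k V)
    (t t' : List {t : W // cs.IsReflection t}) (x y z w : W) :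
    (Soergel.GrBimod.hom (D.twistedBottSamelson x t y)
      (D.twistedBottSamelson z t' w)).toLeft.IsReflexive ∧
    (Soergel.GrBimod.hom (D.twistedBottSamelson x t y)
      (D.twistedBottSamelson z t' w)).toRight.IsReflexive := by
  have key : ∀ (t : List {t : W // cs.IsReflection t}) (x y : W),
      D.HasDualBases (D.twistedBottSamelson x t y) := fun t x y =>
    ((D.hasDualBases_twisted x).tensorR (D.hasDualBases_bottSamelson hk t)).tensorR
      (D.hasDualBases_twisted y)
  obtain ⟨⟨I, _, ⟨b⟩⟩, I', _, ⟨b'⟩⟩ := key t x y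
  obtain ⟨⟨J, _, ⟨c⟩⟩, J', _, ⟨c'⟩⟩ := key t' z w
  exact ⟨Soergel.GrBimod.isReflexive_hom_toLeft b c, Soergel.GrBimod.isReflexive_hom_toRight b' c'⟩
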